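/- Throughout, $\epsilon_c,\epsilon_s,\epsilon_z:\mathbb N\to[0,1]$, $L\in\mathsf{NP}$ is a language with $\mathsf{NP}$ relation $\mathcal R_L$ (decidable in polynomial time, with polynomially long witnesses), $L_n=L\cap\{0,1\}^n$, and PPT means probabilistic polynomial-time. A non-interactive protocol with deterministic verification consists of a PPT algorithm $\mathsf{Gen}$ sampling a reference string $r\leftarrow\mathsf{Gen}(1^n)$, a prover $\pi\leftarrow\mathsf P(x,w;r)$ and a deterministic polynomial-time verifier $\mathsf V(x;r,\pi)\in\{0,1\}$. It is an $(\epsilon_c,\epsilon_s,\epsilon_z)$-NIZK proof for $L$ if * (completeness) for all $x\in L_n$ and $(x,w)\in\mathcal R_L$: $\Pr_{r\leftarrow\mathsf{Gen}(1^n),\,\pi\leftarrow\mathsf P(x,w;r)}[\mathsf V(x;r,\pi)=1]\ge 1-\epsilon_c(n)$; * (soundness) for every prover $\mathsf P^*$ and all $x\in\{0,1\}^n\setminus L_n$: $\Pr_{r\leftarrow\mathsf{Gen}(1^n),\,\pi^*\leftarrow\mathsf P^*(x;r)}[\mathsf V(x;r,\pi^*)=1]\le\epsilon_s(n)$; * (computational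 zero-knowledge) there is a PPT simulator $\mathsf{Sim}$, with $\mathsf{Sim}(x)=\mathsf{Sim}(x;\rho)$ for uniform coins $\rho\in\{0,1\}^{\ell(|x|)}$, such that for every non-uniform PPT distinguisher $D$ and all large enough $n$, for all $x\in L_n$ and $(x,w)\in\mathcal R_L$, the advantage of $D$ in distinguishing $\mathsf{Sim}(x)$ from $(r,\pi)$, where $r\leftarrow\mathsf{Gen}(1^n)$ and $\pi\leftarrow\mathsf P(x,w;r)$, is at most $\epsilon_z(n)$. It is an $(\epsilon_c,\epsilon_s,\epsilon_z)$-NIZK argument if, instead, $\mathsf P$ is PPT and soundness is only required against each PPT prover $\mathsf P^*$, for all large enough $n$. **Lemma.** Suppose $L\in\mathsf{NP}$ has an $(\epsilon_c,\epsilon_s,\epsilon_z)$-NIZK proof or argument with deterministic verification, and let $\mathsf{Sim}$ be a simulator as above, using $\ell(n)$ coins (where $1^n\mapsto 1^{\ell(n)}$ is computable in polynomial time, e.g. $\ell$ a polynomial). For $x\in\{0,1\}^*$ let $f_x(\rho)=(r,\mathsf V(x;r,\pi))$, where $(r,\pi)=\mathsf{Sim}(x;\rho)$. Then the family $\{f_x\}_{x\in\{0,1\}^*}$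 is computable in polynomial time, and there is a polynomial-time (probabilistic) oracle-aided algorithm $R$ such that for every PPT algorithm $\mathcal A$, every polynomial $p$, and all large enough $n\in\mathbb N$: 1. for every $x\in L_n$, if $\mathcal A$ inverts $f_x$ with probability at least $1-1/p(n)$, i.e. $\Pr[\rho'\in\{0,1\}^{\ell(n)}\text{ and }f_x(\rho')=f_x(\rho)]\ge 1-1/p(n)$ for uniform $\rho\in\{0,1\}^{\ell(n)}$ and $\rho'\leftarrow\mathcal A(x,f_x(\rho))$, then $$\Pr[R^{\mathcal A}(x)=1]\ge 1-\epsilon_c(n)-\epsilon_z(n)-\frac1{p(n)};$$ 2. for every $x\in\{0,1\}^n\setminus L_n$, $$\Pr[R^{\mathcal A}(x)=1]\le\epsilon_s(n).$$ Here each query of $R$ to $\mathcal A$ is answered with fresh coins of $\mathcal A$. -/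

import Mathlib

namespace WeakZK

/-- Bit strings, the set `{0,1}^*`. -/
abbrev Str := List Bool

/-- The string `1^n`. -/
def unary (n : ℕ) : Str := List.replicate n true

/-- The uniform distribution on `{0,1}^m`. -/
noncomputable def uniformBits (m : ℕ) : PMF Str :=
  (PMF.uniformOfFintype (Fin m → Bool)).map List.ofFn

/-- The probability that a random bit equals `1`. -/
noncomputable def Pr (p : PMF Bool) : ℝ := (p true).toReal

/-! ### The machine model

Structured programs over finitely many stacks (registers holding bit strings), with a coin-flip
instruction and an oracle instruction. This is a multi-stack (equivalently, multi-tape) Turing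
machine with structured control flow. -/

/-- Programs. Registers are numbered by natural numbers; a program mentions finitely many. -/
inductive Prog : Type
  /-- do nothing -/
  | skip : Prog
  /-- push the bit `b` on register `i` -/
  | push (i : ℕ) (b : Bool) : Prog
  /-- remove the top bit of register `i` (no effect if it is empty) -/
  | pop (i : ℕ) : Prog
  /-- push a fresh uniformly random bit on register `i` -/
  | flip (i : ℕ) : Prog
  /-- query the oracle on the contents of registers `i`, `j`; put the answer in register `k` -/
  | query (i j k : ℕ) : Prog
  /-- first `c`, then `d` -/
  | seq (c d : Prog) : Prog
  /-- inspect register `i`: if it is empty run `e`, if its top bit is `0` run `c₀`, if it is `1`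
  run `c₁` -/
  | cond (i : ℕ) (e c₀ c₁ : Prog) : Prog
  /-- while register `i` is non-empty, run `c` -/
  | loop (i : ℕ) (c : Prog) : Prog

namespace Prog

/-- The program makes no oracle queries. -/
def OracleFree : Prog → Prop
  | query _ _ _ => False
  | seq c d => c.OracleFree ∧ d.OracleFree
  | cond _ e c₀ c₁ => e.OracleFree ∧ c₀.OracleFree ∧ c₁.OracleFree
  | loop _ c => c.OracleFree
  | _ => True

/-- The program flips no coins. -/
def CoinFree : Prog → Prop
  | flip _ => False
  | seq c d => c.CoinFree ∧ d.CoinFree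
  | cond _ e c₀ c₁ => e.CoinFree ∧ c₀.CoinFree ∧ c₁.CoinFree
  | loop _ c => c.CoinFree
  | _ => True

end Prog

/-- The contents of all registers. -/
abbrev Regs := ℕ → Str

/-- A (possibly randomized) oracle, taking two strings. Every query is answered with fresh
randomness, independent of everything else. A deterministic oracle is one with values of the form
`PMF.pure y`. -/
abbrev Oracle := Str → Str → PMF Str

/-- A configuration: the commands still to be executed (first one first), the registers, and the
time spent so far. The machine has halted when there is nothing left to execute. -/
structure Config where
  todo : List Prog
  regs : Regs
  time : ℕ

/-- Execute one instruction. Everything costs one unit of time, except that an oracle query is also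
charged the length of the query, as if it had been written out on a query tape. -/
noncomputable def step (O : Oracle) : Config → PMF Config
  | ⟨[], s, t⟩ => PMF.pure ⟨[], s, t⟩
  | ⟨.skip :: K, s, t⟩ => PMF.pure ⟨K, s, t + 1⟩
  | ⟨.push i b :: K, s, t⟩ => PMF.pure ⟨K, Function.update s i (b :: s i), t + 1⟩
  | ⟨.pop i :: K, s, t⟩ => PMF.pure ⟨K, Function.update s i (s i).tail, t + 1⟩
  | ⟨.flip i :: K, s, t⟩ =>
      (PMF.uniformOfFintype Bool).bind fun b =>
        PMF.pure ⟨K, Function.update s i (b :: s i), t + 1⟩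
  | ⟨.query i j k :: K, s, t⟩ =>
      (O (s i) (s j)).bind fun y =>
        PMF.pure ⟨K, Function.update s k y, t + 1 + ((s i).length + (s j).length)⟩
  | ⟨.seq c d :: K, s, t⟩ => PMF.pure ⟨c :: d :: K, s, t + 1⟩
  | ⟨.cond i e c₀ c₁ :: K, s, t⟩ =>
      PMF.pure (match s i with
        | [] => ⟨e :: K, s, t + 1⟩
        | false :: _ => ⟨c₀ :: K, s, t + 1⟩
        | true :: _ => ⟨c₁ :: K, s, t + 1⟩)
  | ⟨.loop i c :: K, s, t⟩ =>
      PMF.pure (match s i with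
        | [] => ⟨K, s, t + 1⟩
        | _ :: _ => ⟨c :: .loop i c :: K, s, t + 1⟩)

/-- Execute `m` instructions (or fewer, if the machine halts before). -/
noncomputable def run (O : Oracle) : ℕ → Config → PMF Config
  | 0, γ => PMF.pure γ
  | m + 1, γ => (step O γ).bind (run O m)

/-- The initial configuration: the `k` inputs are in registers `0, …, k - 1`, all other registers
are empty. -/
def start (c : Prog) {k : ℕ} (a : Fin k → Str) : Config :=
  ⟨[c], fun i => if h : i < k then a ⟨i, h⟩ else [], 0⟩

/-- Reading a string as the result of a computation: the content of register `0`. -/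
def outStr (s : Regs) : Str := s 0

/-- Reading a pair of strings: registers `0` and `1`. -/
def outPair (s : Regs) : Str × Str := (s 0, s 1)

/-- Reading a bit: `1` (accept) if register `0` holds the string `1`, and `0` otherwise. -/
def outBit (s : Regs) : Bool := decide (s 0 = [true])

/-- On input `a` and with oracle `O`, the program `c` halts within time `T`, whatever the coins and
the oracle answers are, and its result (read by `out`) has distribution `μ`. -/
def Prog.OutputsWithin {β : Type} (out : Regs → β) (c : Prog) (O : Oracle) {k : ℕ}
    (a : Fin k → Str) (T : ℕ) (μ : PMF β) : Prop :=
  (∀ γ ∈ (run O T (start c a)).support, γ.todo = [] ∧ γ.time ≤ T) ∧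
    (run O T (start c a)).map (fun γ => out γ.regs) = μ

/-- The total length of the inputs. -/
def inputLength {k : ℕ} (a : Fin k → Str) : ℕ := ∑ i, (a i).length

/-- `f` is computed by a deterministic algorithm in time polynomial in the input length. -/
def IsPolyTime {β : Type} (out : Regs → β) {k : ℕ} (f : (Fin k → Str) → β) : Prop :=
  ∃ (c : Prog) (q : Polynomial ℕ), c.OracleFree ∧ c.CoinFree ∧
    ∀ (O : Oracle) (a : Fin k → Str),
      c.OutputsWithin out O a (q.eval (inputLength a)) (PMF.pure (f a))

/-- `F a` is the output distribution, on input `a`, of a probabilistic algorithm that runs in time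
polynomial in the input length. -/
def IsPPT {β : Type} (out : Regs → β) {k : ℕ} (F : (Fin k → Str) → PMF β) : Prop :=
  ∃ (c : Prog) (q : Polynomial ℕ), c.OracleFree ∧
    ∀ (O : Oracle) (a : Fin k → Str), c.OutputsWithin out O a (q.eval (inputLength a)) (F a)

/-- `R O x` is the output distribution, on input `x` and with access to `O`, of a (probabilistic)
oracle-aided algorithm whose running time is polynomial in the length of `x`, for every oracle. -/
def IsPolyTimeOracleAlg (R : Oracle → Str → PMF Bool) : Prop :=
  ∃ (c : Prog) (q : Polynomial ℕ), ∀ (O : Oracle) (x : Str),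
    c.OutputsWithin outBit O ![x] (q.eval x.length) (R O x)

/-! ### NP and computational indistinguishability -/

/-- `Rel` is an NP relation for the language `L`: it is decidable in polynomial time, witnesses have
polynomial length, and `L` is the set of strings that have a witness. So `L ∈ NP` iff such a `Rel`
exists. -/
def IsNPRelation (L : Set Str) (Rel : Str → Str → Bool) : Prop :=
  IsPolyTime outBit (fun a : Fin 2 → Str => Rel (a 0) (a 1)) ∧
  (∃ q : Polynomial ℕ, ∀ x w, Rel x w = true → w.length ≤ q.eval x.length) ∧
  ∀ x, x ∈ L ↔ ∃ w, Rel x w = true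

/-- `Δ_c(X; Y) ≤ ε`, for families of distributions on pairs of strings indexed by `ι`, the index `i`
having size `size i`: for every non-uniform PPT distinguisher (a PPT algorithm `D` with an advice
string of polynomial length for each size), the distinguishing advantage is at most `ε n` for all
indices of size `n`, for all large enough `n`. Equivalently: for every choice of one index of each
size, the resulting ensembles indexed by `n` are `ε`-computationally indistinguishable. -/
def CompIndist {ι : Type} (size : ι → ℕ) (X Y : ι → PMF (Str × Str)) (ε : ℕ → ℝ) : Prop :=
  ∀ D : Str → Str × Str → PMF Bool,
    IsPPT outBit (fun a : Fin 3 → Str => D (a 0) (a 1, a 2)) →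
    ∀ advice : ℕ → Str,
      (∃ q : Polynomial ℕ, ∀ n, (advice n).length ≤ q.eval n) →
      ∃ n₀ : ℕ, ∀ n ≥ n₀, ∀ i, size i = n →
        |Pr ((X i).bind (D (advice n))) - Pr ((Y i).bind (D (advice n)))| ≤ ε n

/-! ### Non-interactive zero-knowledge -/

/-- The algorithms of a non-interactive protocol with deterministic verification. -/
structure NIProtocol where
  /-- samples the common reference string, on input `1^n` -/
  Gen : Str → PMF Str
  /-- the honest prover `P(x, w; r)` -/
  P : Str → Str → Str → PMF Str
  /-- the verifier `V(x; r, π)` -/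
  V : Str → Str → Str → Bool
  gen_ppt : IsPPT outStr (fun a : Fin 1 → Str => Gen (a 0))
  v_polyTime : IsPolyTime outBit (fun a : Fin 3 → Str => V (a 0) (a 1) (a 2))

namespace NIProtocol

variable (Z : NIProtocol)

/-- The view of the verifier: the reference string and the prover's message. -/
noncomputable def view (x w : Str) : PMF (Str × Str) :=
  (Z.Gen (unary x.length)).bind fun r => (Z.P x w r).map fun π => (r, π)

/-- Does `V` accept on input `x` when the (arbitrary) prover `Q` sends the message? -/
noncomputable def verdict (Q : Str → Str → PMF Str) (x : Str) : PMF Bool :=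
  (Z.Gen (unary x.length)).bind fun r => (Q x r).map fun π => Z.V x r π

/-- Completeness with error `εc`. -/
def Complete (Rel : Str → Str → Bool) (εc : ℕ → ℝ) : Prop :=
  ∀ x w, Rel x w = true → 1 - εc x.length ≤ Pr (Z.verdict (fun x r => Z.P x w r) x)

/-- Statistical soundness with error `εs`: against all provers. -/
def StatSound (L : Set Str) (εs : ℕ → ℝ) : Prop :=
  ∀ Q : Str → Str → PMF Str, ∀ x ∉ L, Pr (Z.verdict Q x) ≤ εs x.length

/-- Computational soundness with error `εs`: against all PPT provers, for large enough inputs. -/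
def CompSound (L : Set Str) (εs : ℕ → ℝ) : Prop :=
  ∀ Q : Str → Str → PMF Str, IsPPT outStr (fun a : Fin 2 → Str => Q (a 0) (a 1)) →
    ∃ n₀ : ℕ, ∀ n ≥ n₀, ∀ x ∉ L, x.length = n → Pr (Z.verdict Q x) ≤ εs n

end NIProtocol

/-- A probabilistic polynomial-time simulator, with its coins made explicit: on input `x` it draws
`ρ` uniformly from `{0,1}^ℓ(|x|)` and outputs the pair `(r, π) = sim x ρ`. The number of coins `ℓ`
can be any function such that `1^n ↦ 1^ℓ(n)` is computable in polynomial time (for example any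
polynomial). -/
structure Simulator where
  ℓ : ℕ → ℕ
  sim : Str → Str → Str × Str
  ℓ_polyTime : IsPolyTime outStr (fun a : Fin 1 → Str => unary (ℓ (a 0).length))
  sim_polyTime : IsPolyTime outPair (fun a : Fin 2 → Str => sim (a 0) (a 1))

namespace Simulator

/-- The output distribution `Sim(x)`. -/
noncomputable def dist (S : Simulator) (x : Str) : PMF (Str × Str) :=
  (uniformBits (S.ℓ x.length)).map (S.sim x)

/-- `S` simulates the view of the verifier in the protocol `Z`, with error `εz`. -/
def ZeroKnowledge (S : Simulator) (Z : NIProtocol) (Rel : Str → Str → Bool) (εz : ℕ → ℝ) : Prop :=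
  CompIndist (ι := {xw : Str × Str // Rel xw.1 xw.2 = true}) (fun i => i.1.1.length)
    (fun i => S.dist i.1.1) (fun i => Z.view i.1.1 i.1.2) εz

end Simulator

/-- `Z` is an `(εc, εs, εz)`-NIZK proof for the language `L` with NP relation `Rel`. -/
def IsNIZKProof (Z : NIProtocol) (L : Set Str) (Rel : Str → Str → Bool) (εc εs εz : ℕ → ℝ) :
    Prop :=
  Z.Complete Rel εc ∧ Z.StatSound L εs ∧ ∃ S : Simulator, S.ZeroKnowledge Z Rel εz

/-- `Z` is an `(εc, εs, εz)`-NIZK argument for the language `L` with NP relation `Rel`: the honest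
prover is efficient, and soundness is only required against efficient provers. -/
def IsNIZKArgument (Z : NIProtocol) (L : Set Str) (Rel : Str → Str → Bool) (εc εs εz : ℕ → ℝ) :
    Prop :=
  IsPPT outStr (fun a : Fin 3 → Str => Z.P (a 0) (a 1) (a 2)) ∧
  Z.Complete Rel εc ∧ Z.CompSound L εs ∧ ∃ S : Simulator, S.ZeroKnowledge Z Rel εz

/-! ### Inverting a function family -/

/-- Does `A` invert `f_x : {0,1}^m → {0,1}^*` (where `f_x = F x`)? Draw a uniform `ρ ∈ {0,1}^m`, run
`A` on `x` and `f_x(ρ)`, and check that its output is a preimage of `f_x(ρ)` in `{0,1}^m`. -/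
noncomputable def inverts (F : Str → Str → Str) (m : ℕ) (A : Str → Str → PMF Str) (x : Str) :
    PMF Bool :=
  (uniformBits m).bind fun ρ =>
    (A x (F x ρ)).map fun ρ' => decide (ρ'.length = m ∧ F x ρ' = F x ρ)

end WeakZK

open WeakZK

namespace WeakZK

/-! ### Execution of programs with a continuation -/

/-! The reduction samples an honest reference string `r`, asks the inverter for a preimage of the
value (accept, `r`) under `f_x`, and accepts iff the answer really is one.

Soundness: a preimage of (accept, `r`) consists of simulator coins whose proof makes the verifier
accept with the reference string `r`. Sending that proof is a cheating strategy, efficient whenever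
the inverter is, and it convinces the verifier at least as often as the reduction accepts
(`Pr_reduction_le_verdict`). This covers both statistical and computational soundness.

Completeness: whether the inverter succeeds at `f_x(ρ)` depends on `ρ` only through the simulated
view, so the inversion game is an efficient test applied to that view (`inverts_eq`). By
zero-knowledge the test passes on a real view with probability smaller by at most `εz`. A real view
is rejecting with probability at most `εc`, and on an accepting one the test is exactly the check of
the reduction (`Pr_inversionTest_view_le`). The distinguisher needs to know `x`, which is its
advice; the advice at each length is a worst-case input, which makes the threshold uniform in `x`.

The remaining work is to show in the machine model that the function family, the reduction, the
cheating prover and the test run in polynomial time. `Exec` specifies a program relative to an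
arbitrary continuation, so such specifications compose. `Efficient.bind` turns this into one
composition rule for algorithms; it needs bounds on output lengths as well as on running times,
because the output of one algorithm is the input of the next. Oracle answers have no a priori length
bound, so the reduction reads only a prefix of each, one symbol longer than a valid preimage. -/

/-- Rename the registers of a program. -/
def Prog.rename (e : ℕ → ℕ) : Prog → Prog
  | .skip => .skip
  | .push i b => .push (e i) b
  | .pop i => .pop (e i)
  | .flip i => .flip (e i)
  | .query i j k => .query (e i) (e j) (e k)
  | .seq c d => .seq (c.rename e) (d.rename e)
  | .cond i c c₀ c₁ => .cond (e i) (c.rename e) (c₀.rename e) (c₁.rename e)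
  | .loop i c => .loop (e i) (c.rename e)

/-- From `γ` the machine halts within `N` steps and by the time `D`, and the final contents of the
registers have distribution `μ`. -/
def Halts (O : Oracle) (γ : Config) (N D : ℕ) (μ : PMF Regs) : Prop :=
  (∀ γ' ∈ (run O N γ).support, γ'.todo = [] ∧ γ'.time ≤ D) ∧ (run O N γ).map Config.regs = μ

/-- From registers `s`, the program `c` takes time at most `T` and leaves the registers distributed
according to `μ`, whatever is executed afterwards. -/
def Exec (O : Oracle) (c : Prog) (s : Regs) (T : ℕ) (μ : PMF Regs) : Prop :=
  ∀ (K : List Prog) (t N D : ℕ) (ν : Regs → PMF Regs),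
    (∀ s' ∈ μ.support, ∀ t' ≤ t + T, Halts O ⟨K, s', t'⟩ N D (ν s')) →
      Halts O ⟨c :: K, s, t⟩ (T + N) D (μ.bind ν)

theorem bind_congr_support {α β : Type} (p : PMF α) {f g : α → PMF β}
    (h : ∀ a ∈ p.support, f a = g a) : p.bind f = p.bind g := by
  ext b
  simp only [PMF.bind_apply]
  refine tsum_congr fun a => ?_
  by_cases ha : p a = 0
  · simp [ha]
  · rw [h a ((PMF.mem_support_iff _ _).2 ha)]

theorem run_nil (O : Oracle) (N : ℕ) (s : Regs) (t : ℕ) :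
    run O N ⟨[], s, t⟩ = PMF.pure ⟨[], s, t⟩ := by
  induction N with
  | zero => rfl
  | succ N ih => simp [run, step, ih]

theorem halts_nil (O : Oracle) (N : ℕ) (s : Regs) {t D : ℕ} (h : t ≤ D) :
    Halts O ⟨[], s, t⟩ N D (PMF.pure s) := by
  simp [Halts, run_nil, PMF.pure_map, h]

theorem Halts.of_step {O : Oracle} {γ : Config} {N D : ℕ} {ν : Config → PMF Regs}
    (h : ∀ γ₁ ∈ (step O γ).support, Halts O γ₁ N D (ν γ₁)) :
    Halts O γ (N + 1) D ((step O γ).bind ν) := by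
  refine ⟨fun γ' hγ' => ?_, ?_⟩
  · simp only [run, PMF.mem_support_bind_iff] at hγ'
    obtain ⟨γ₁, h₁, h₂⟩ := hγ'
    exact (h γ₁ h₁).1 γ' h₂
  · simp only [run, PMF.map_bind]
    exact bind_congr_support _ fun γ₁ h₁ => (h γ₁ h₁).2

theorem Halts.after_step {O : Oracle} {γ : Config} {N D : ℕ} {μ : PMF Regs}
    (h : Halts O γ (N + 1) D μ) :
    ∀ γ₁ ∈ (step O γ).support, Halts O γ₁ N D ((run O N γ₁).map Config.regs) :=
  fun γ₁ h₁ => ⟨fun γ' hγ' => h.1 γ' (by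
    simp only [run, PMF.mem_support_bind_iff]
    exact ⟨γ₁, h₁, hγ'⟩), rfl⟩

/-- A halted configuration is a fixed point of `step`, so surplus steps change nothing and step
budgets may be rounded up. -/
theorem Halts.succ {O : Oracle} {N D : ℕ} :
    ∀ {γ : Config} {μ : PMF Regs}, Halts O γ N D μ → Halts O γ (N + 1) D μ := by
  induction N with
  | zero =>
    rintro ⟨K, s, t⟩ μ ⟨h₁, h₂⟩
    obtain ⟨rfl, ht⟩ : K = [] ∧ t ≤ D := by simpa [run] using h₁
    rw [← h₂]
    simpa [run, PMF.pure_map] using halts_nil O 1 s ht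
  | succ N ih =>
    intro γ μ h
    have := Halts.of_step fun γ₁ h₁ => ih (h.after_step γ₁ h₁)
    rwa [← PMF.map_bind, show (step O γ).bind (run O N) = run O (N + 1) γ from rfl, h.2] at this

theorem Halts.mono {O : Oracle} {γ : Config} {N N' D : ℕ} {μ : PMF Regs}
    (h : Halts O γ N D μ) (hN : N ≤ N') : Halts O γ N' D μ := by
  induction hN with
  | refl => exact h
  | step _ ih => exact ih.succ

theorem Exec.mono {O : Oracle} {c : Prog} {s : Regs} {T T' : ℕ} {μ : PMF Regs}
    (h : Exec O c s T μ) (hT : T ≤ T') : Exec O c s T' μ := fun K t N D ν hν =>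
  (h K t N D ν fun s' hs' t' ht' => hν s' hs' t' (by omega)).mono (by omega)

/-- A step to a known configuration. -/
theorem Halts.of_pure_step {O : Oracle} {γ γ₁ : Config} {N D : ℕ} {μ : PMF Regs}
    (hs : step O γ = PMF.pure γ₁) (h : Halts O γ₁ N D μ) : Halts O γ (N + 1) D μ := by
  have := Halts.of_step (O := O) (γ := γ) (N := N) (D := D) (ν := fun _ => μ) (by
    rw [hs]; simpa using h)
  simpa [hs] using this

theorem exec_of_step {O : Oracle} {c : Prog} {s s' : Regs}
    (h : ∀ K t, step O ⟨c :: K, s, t⟩ = PMF.pure ⟨K, s', t + 1⟩) :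
    Exec O c s 1 (PMF.pure s') := by
  intro K t N D ν hν
  rw [PMF.pure_bind, add_comm]
  exact Halts.of_pure_step (h K t) (hν s' (by simp) _ le_rfl)

/-! ### Execution rules for the instructions -/

theorem exec_skip (O : Oracle) (s : Regs) : Exec O .skip s 1 (PMF.pure s) :=
  exec_of_step fun _ _ => rfl

theorem exec_push (O : Oracle) (s : Regs) (i : ℕ) (b : Bool) :
    Exec O (.push i b) s 1 (PMF.pure (Function.update s i (b :: s i))) :=
  exec_of_step fun _ _ => rfl

theorem exec_pop (O : Oracle) (s : Regs) (i : ℕ) :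
    Exec O (.pop i) s 1 (PMF.pure (Function.update s i (s i).tail)) :=
  exec_of_step fun _ _ => rfl

/-- A query is a single step but is charged its length. As `T` in `Exec` bounds both steps and time,
the larger of the two is taken. -/
theorem exec_query (O : Oracle) (s : Regs) (i j k : ℕ) :
    Exec O (.query i j k) s (1 + ((s i).length + (s j).length))
      ((O (s i) (s j)).map (Function.update s k)) := by
  intro K t N D ν hν
  have := Halts.of_step (O := O) (γ := ⟨.query i j k :: K, s, t⟩) (N := N) (D := D)
    (ν := fun γ => ν γ.regs) (by
      intro γ₁ h₁
      simp only [step, PMF.mem_support_bind_iff, PMF.mem_support_pure_iff] at h₁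
      obtain ⟨y, hy, rfl⟩ := h₁
      exact hν _ ((PMF.mem_support_map_iff _ _ _).2 ⟨y, hy, rfl⟩) _ (by omega))
  have h₂ : ((O (s i) (s j)).map (Function.update s k)).bind ν =
      (step O ⟨.query i j k :: K, s, t⟩).bind fun γ => ν γ.regs := by
    simp [step, PMF.bind_bind, PMF.bind_map, Function.comp_def]
  rw [h₂]
  exact this.mono (by omega)

/-- The specification of `d` serves as the continuation of `c`; associativity of `bind` does the
rest. The extra unit of time is the unfolding of `seq`. -/
theorem Exec.seq {O : Oracle} {c d : Prog} {s : Regs} {T T' : ℕ} {μ : PMF Regs}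
    {ξ : Regs → PMF Regs} (hc : Exec O c s T μ) (hd : ∀ s' ∈ μ.support, Exec O d s' T' (ξ s')) :
    Exec O (.seq c d) s (T + T' + 1) (μ.bind ξ) := by
  intro K t N D ν hν
  have : Halts O ⟨.seq c d :: K, s, t⟩ (T + (T' + N) + 1) D (μ.bind fun s' => (ξ s').bind ν) :=
    Halts.of_pure_step rfl (hc _ _ _ _ _ fun s' hs' t' ht' => hd s' hs' _ _ _ _ _
      fun s'' hs'' t'' ht'' => hν s'' (by
        simp only [PMF.mem_support_bind_iff]; exact ⟨s', hs', hs''⟩) _ (by omega))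
  rw [PMF.bind_bind]
  exact this.mono (by omega)

theorem Exec.seq_pure {O : Oracle} {c d : Prog} {s s₁ : Regs} {T T' : ℕ} {μ : PMF Regs}
    (hc : Exec O c s T (PMF.pure s₁)) (hd : Exec O d s₁ T' μ) :
    Exec O (.seq c d) s (T + T' + 1) μ := by
  simpa using hc.seq (ξ := fun _ => μ) (by simpa using hd)

theorem Exec.of_unfold {O : Oracle} {c d : Prog} {s : Regs} {T : ℕ} {μ : PMF Regs}
    (h : ∀ K t, step O ⟨c :: K, s, t⟩ = PMF.pure ⟨d :: K, s, t + 1⟩) (hd : Exec O d s T μ) :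
    Exec O c s (T + 1) μ := by
  intro K t N D ν hν
  have := Halts.of_pure_step (h K t) (hd K (t + 1) N D ν fun s' hs' t' ht' => hν s' hs' _ (by omega))
  exact this.mono (by omega)

theorem Exec.cond_nil {O : Oracle} {i : ℕ} {c c₀ c₁ : Prog} {s : Regs} {T : ℕ} {μ : PMF Regs}
    (hs : s i = []) (h : Exec O c s T μ) : Exec O (.cond i c c₀ c₁) s (T + 1) μ :=
  Exec.of_unfold (fun K t => by simp [step, hs]) h

theorem Exec.cond_cons {O : Oracle} {i : ℕ} {c c₀ c₁ : Prog} {s : Regs} {T : ℕ} {μ : PMF Regs}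
    {b : Bool} {l : Str} (hs : s i = b :: l) (h : Exec O (if b then c₁ else c₀) s T μ) :
    Exec O (.cond i c c₀ c₁) s (T + 1) μ :=
  Exec.of_unfold (fun K t => by cases b <;> simp [step, hs]) h

theorem exec_loop_nil {O : Oracle} {i : ℕ} {c : Prog} {s : Regs} (hs : s i = []) :
    Exec O (.loop i c) s 1 (PMF.pure s) :=
  exec_of_step fun K t => by simp [step, hs]

theorem Exec.loop_cons {O : Oracle} {i : ℕ} {c : Prog} {s s₁ : Regs} {T T' : ℕ} {μ : PMF Regs}
    (hs : s i ≠ []) (hc : Exec O c s T (PMF.pure s₁)) (hl : Exec O (.loop i c) s₁ T' μ) :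
    Exec O (.loop i c) s (T + T' + 1) μ := by
  intro K t N D ν hν
  have h₁ : step O ⟨.loop i c :: K, s, t⟩ = PMF.pure ⟨c :: .loop i c :: K, s, t + 1⟩ := by
    obtain ⟨b, l, h⟩ := List.exists_cons_of_ne_nil hs
    simp [step, h]
  have := Halts.of_pure_step h₁ (hc (.loop i c :: K) (t + 1) (T' + N) D (fun _ => μ.bind ν) (by
    intro s' hs' t' ht'
    obtain rfl : s' = s₁ := by simpa using hs'
    exact hl K t' N D ν fun s'' hs'' t'' ht'' => hν s'' hs'' _ (by omega)))
  rw [PMF.pure_bind] at this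
  exact this.mono (by omega)

/-! ### Running a program on a part of the registers -/

theorem extend_update {e : ℕ → ℕ} (he : e.Injective) (u s : Regs) (i : ℕ) (v : Str) :
    Function.extend e (Function.update u i v) s =
      Function.update (Function.extend e u s) (e i) v := by
  funext j
  by_cases hj : ∃ l, e l = j
  · obtain ⟨l, rfl⟩ := hj
    rw [he.extend_apply]
    by_cases hl : l = i
    · subst hl; simp
    · simp [Function.update_of_ne hl, Function.update_of_ne (he.ne hl), he.extend_apply]
  · rw [Function.extend_apply' _ _ _ hj, Function.update_of_ne, Function.extend_apply' _ _ _ hj]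
    rintro rfl
    exact hj ⟨i, rfl⟩

/-- Frame property: a renamed program sees only the registers in the range of `e`. One step of it
commutes with embedding the small machine into a larger one that has other registers `s`, pending
commands `K` and a clock ahead by `d`. -/
theorem step_rename (O : Oracle) {e : ℕ → ℕ} (he : e.Injective) (c : Prog) (L K : List Prog)
    (u s : Regs) (t d : ℕ) :
    step O ⟨c.rename e :: (L.map (Prog.rename e) ++ K), Function.extend e u s, t + d⟩ =
      (step O ⟨c :: L, u, t⟩).map fun γ =>
        ⟨γ.todo.map (Prog.rename e) ++ K, Function.extend e γ.regs s, γ.time + d⟩ := by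
  have hu : ∀ i, Function.extend e u s (e i) = u i := fun i => he.extend_apply _ _ _
  cases c with
  | skip => simp [Prog.rename, step, PMF.pure_map, add_right_comm]
  | push i b => simp [Prog.rename, step, PMF.pure_map, extend_update he, hu, add_right_comm]
  | pop i => simp [Prog.rename, step, PMF.pure_map, extend_update he, hu, add_right_comm]
  | flip i =>
    simp only [Prog.rename, step, PMF.map_bind, PMF.pure_map, extend_update he, hu]
    simp [add_right_comm]
  | query i j k =>
    simp only [Prog.rename, step, PMF.map_bind, PMF.pure_map, extend_update he, hu]
    simp [add_right_comm]
  | seq c d => simp [Prog.rename, step, PMF.pure_map, add_right_comm]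
  | cond i c c₀ c₁ =>
    rcases h : u i with _ | ⟨_ | _, l⟩ <;>
      simp [Prog.rename, step, PMF.pure_map, hu, h, add_right_comm]
  | loop i c =>
    rcases h : u i with _ | ⟨b, l⟩ <;>
      simp [Prog.rename, step, PMF.pure_map, hu, h, add_right_comm]

/-- Iterates the frame property until the small machine halts, after which `K` takes over. If it
halts early, the unused steps are absorbed by `Halts.mono`. -/
theorem halts_rename {O : Oracle} {e : ℕ → ℕ} (he : e.Injective) {K : List Prog} {s : Regs}
    {d B N' D : ℕ} {ν : Regs → PMF Regs} (N : ℕ) :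
    ∀ (L : List Prog) (u : Regs) (t : ℕ),
      (∀ γ ∈ (run O N ⟨L, u, t⟩).support, γ.todo = [] ∧ γ.time ≤ B) →
      (∀ u' ∈ ((run O N ⟨L, u, t⟩).map Config.regs).support, ∀ t' ≤ B + d,
        Halts O ⟨K, Function.extend e u' s, t'⟩ N' D (ν u')) →
      Halts O ⟨L.map (Prog.rename e) ++ K, Function.extend e u s, t + d⟩ (N + N') D
        (((run O N ⟨L, u, t⟩).map Config.regs).bind ν) := by
  have hnil : ∀ (M : ℕ) (u : Regs) (t : ℕ),
      (∀ γ ∈ (run O M ⟨[], u, t⟩).support, γ.todo = [] ∧ γ.time ≤ B) →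
      (∀ u' ∈ ((run O M ⟨[], u, t⟩).map Config.regs).support, ∀ t' ≤ B + d,
        Halts O ⟨K, Function.extend e u' s, t'⟩ N' D (ν u')) →
      Halts O ⟨([] : List Prog).map (Prog.rename e) ++ K, Function.extend e u s, t + d⟩ (M + N') D
        (((run O M ⟨[], u, t⟩).map Config.regs).bind ν) := by
    intro M u t h₁ h₂
    simp only [run_nil, PMF.pure_map, PMF.pure_bind] at h₁ h₂ ⊢
    have ht : t ≤ B := by simpa using h₁
    exact (h₂ u (by simp) (t + d) (by omega)).mono (by omega)
  induction N with
  | zero =>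
    intro L u t h₁ h₂
    obtain ⟨rfl, -⟩ : L = [] ∧ t ≤ B := by simpa [run] using h₁
    exact hnil 0 u t h₁ h₂
  | succ N ih =>
    rintro (_ | ⟨c, L⟩) u t h₁ h₂
    · exact hnil (N + 1) u t h₁ h₂
    · have hst := step_rename O he c L K u s t d
      have key : ∀ γ ∈ (step O ⟨c :: L, u, t⟩).support,
          Halts O ⟨γ.todo.map (Prog.rename e) ++ K, Function.extend e γ.regs s, γ.time + d⟩
            (N + N') D (((run O N γ).map Config.regs).bind ν) := by
        rintro ⟨L', u', t'⟩ hγ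
        refine ih L' u' t' (fun γ' hγ' => h₁ γ' ?_) (fun v hv => h₂ v ?_)
        · simp only [run, PMF.mem_support_bind_iff]
          exact ⟨_, hγ, hγ'⟩
        · simp only [run, PMF.map_bind, PMF.mem_support_bind_iff]
          exact ⟨_, hγ, hv⟩
      have h₃ : ∀ M, run O (M + 1) ⟨c.rename e :: (L.map (Prog.rename e) ++ K),
          Function.extend e u s, t + d⟩ = (step O ⟨c :: L, u, t⟩).bind fun γ =>
            run O M ⟨γ.todo.map (Prog.rename e) ++ K, Function.extend e γ.regs s, γ.time + d⟩ := by
        intro M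
        rw [run, hst, PMF.bind_map]
        rfl
      have h₄ : N + 1 + N' = (N + N') + 1 := by omega
      refine ⟨fun γ' hγ' => ?_, ?_⟩
      · rw [h₄, List.map_cons, List.cons_append, h₃, PMF.mem_support_bind_iff] at hγ'
        obtain ⟨γ, hγ, hγ'⟩ := hγ'
        exact (key γ hγ).1 γ' hγ'
      · rw [h₄, List.map_cons, List.cons_append, h₃, PMF.map_bind]
        simp only [run, PMF.map_bind, PMF.bind_bind]
        exact bind_congr_support _ fun γ hγ => (key γ hγ).2

/-- The registers with the inputs `a`. -/
def startRegs {k : ℕ} (a : Fin k → Str) : Regs := fun i => if h : i < k then a ⟨i, h⟩ else []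

theorem start_eq (c : Prog) {k : ℕ} (a : Fin k → Str) : start c a = ⟨[c], startRegs a, 0⟩ := rfl

/-- Makes a stand-alone program callable as a subroutine: it suffices that the registers in the
range of `e` look like a fresh start, and all others survive the call. -/
theorem Prog.OutputsWithin.exec {β : Type} {out : Regs → β} {c : Prog} {O : Oracle} {k : ℕ}
    {a : Fin k → Str} {T : ℕ} {μ : PMF β} (h : c.OutputsWithin out O a T μ) {e : ℕ → ℕ}
    (he : e.Injective) {s : Regs} (hs : ∀ i, s (e i) = startRegs a i) :
    Exec O (c.rename e) s T
      (((run O T (start c a)).map Config.regs).map fun u => Function.extend e u s) := by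
  intro K t N D ν hν
  have hs' : Function.extend e (startRegs a) s = s := by
    funext j
    by_cases hj : ∃ l, e l = j
    · obtain ⟨l, rfl⟩ := hj
      rw [he.extend_apply, hs]
    · rw [Function.extend_apply' _ _ _ hj]
  have := halts_rename (O := O) he (K := K) (s := s) (d := t) (B := T) (N' := N) (D := D)
    (ν := fun u => ν (Function.extend e u s)) T [c] (startRegs a) 0 h.1 (by
      intro u' hu' t' ht'
      exact hν _ ((PMF.mem_support_map_iff _ _ _).2 ⟨u', hu', rfl⟩) _ (by omega))
  rw [PMF.bind_map]
  simpa [hs', start_eq, Function.comp_def] using this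

theorem Exec.outputsWithin {β : Type} {out : Regs → β} {c : Prog} {O : Oracle} {k : ℕ}
    {a : Fin k → Str} {T : ℕ} {μ : PMF Regs} (h : Exec O c (startRegs a) T μ) :
    c.OutputsWithin out O a T (μ.map out) := by
  have := h [] 0 0 T PMF.pure fun s' _ t' ht' => halts_nil O 0 s' (by omega)
  refine ⟨this.1, ?_⟩
  have h₂ := this.2
  rw [PMF.bind_pure] at h₂
  rw [← h₂, PMF.map_comp, start_eq]
  rfl

/-! ### Growth of registers in oracle-free programs -/

theorem step_length_le {O : Oracle} {γ γ' : Config} (hγ : ∀ c ∈ γ.todo, c.OracleFree)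
    (h : γ' ∈ (step O γ).support) :
    (∀ c ∈ γ'.todo, c.OracleFree) ∧ ∀ i, (γ'.regs i).length ≤ (γ.regs i).length + 1 := by
  obtain ⟨_ | ⟨c, K⟩, s, t⟩ := γ
  · obtain rfl : γ' = _ := by simpa [step] using h
    exact ⟨hγ, fun i => by simp⟩
  · have hK : ∀ c ∈ K, c.OracleFree := fun d hd => hγ d (List.mem_cons_of_mem _ hd)
    have hc : c.OracleFree := hγ c List.mem_cons_self
    have hupd : ∀ (j : ℕ) (v : Str), v.length ≤ (s j).length + 1 →
        ∀ i, (Function.update s j v i).length ≤ (s i).length + 1 := by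
      intro j v hv i
      by_cases hi : i = j
      · subst hi; simpa using hv
      · simp [Function.update_of_ne hi]
    cases c with
    | skip =>
      obtain rfl : γ' = _ := by simpa [step] using h
      exact ⟨hK, fun i => by simp⟩
    | push j b =>
      obtain rfl : γ' = _ := by simpa [step] using h
      exact ⟨hK, hupd _ _ (by simp)⟩
    | pop j =>
      obtain rfl : γ' = _ := by simpa [step] using h
      exact ⟨hK, hupd _ _ (by simp; omega)⟩
    | flip j =>
      simp only [step, PMF.mem_support_bind_iff, PMF.mem_support_pure_iff] at h
      obtain ⟨b, -, rfl⟩ := h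
      exact ⟨hK, hupd _ _ (by simp)⟩
    -- The only instruction that can lengthen a register by more than one symbol.
    | query i j k => exact hc.elim
    | seq c d =>
      obtain rfl : γ' = _ := by simpa [step] using h
      refine ⟨?_, fun i => by simp⟩
      simp only [List.mem_cons, forall_eq_or_imp]
      exact ⟨hc.1, hc.2, hK⟩
    | cond j c c₀ c₁ =>
      rcases hj : s j with _ | ⟨_ | _, l⟩ <;> simp only [step, hj] at h <;>
        obtain rfl : γ' = _ := by simpa using h
      all_goals
        refine ⟨?_, fun i => by simp⟩
        simp only [List.mem_cons, forall_eq_or_imp]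
      exacts [⟨hc.1, hK⟩, ⟨hc.2.1, hK⟩, ⟨hc.2.2, hK⟩]
    | loop j c =>
      rcases hj : s j with _ | ⟨b, l⟩ <;> simp only [step, hj] at h <;>
        obtain rfl : γ' = _ := by simpa using h
      · exact ⟨hK, fun i => by simp⟩
      · refine ⟨?_, fun i => by simp⟩
        simp only [List.mem_cons, forall_eq_or_imp]
        exact ⟨hc, hc, hK⟩

theorem run_length_le {O : Oracle} (N : ℕ) : ∀ {γ γ' : Config}, (∀ c ∈ γ.todo, c.OracleFree) →
    γ' ∈ (run O N γ).support → ∀ i, (γ'.regs i).length ≤ (γ.regs i).length + N := by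
  induction N with
  | zero =>
    intro γ γ' _ h i
    obtain rfl : γ' = γ := by simpa [run] using h
    simp
  | succ N ih =>
    intro γ γ' hγ h i
    simp only [run, PMF.mem_support_bind_iff] at h
    obtain ⟨γ₁, h₁, h₂⟩ := h
    have := step_length_le hγ h₁
    have h₃ := ih this.1 h₂ i
    have h₄ := this.2 i
    omega

/-! ### Moving the contents of registers -/

/-- Push `b` on all the registers in `l`. -/
def pushAll (l : List ℕ) (b : Bool) : Prog := l.foldr (fun r c => .seq (.push r b) c) .skip

/-- Empty the register `i`, moving its contents (reversed) to each of the registers in `l`. -/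
def moveTo (i : ℕ) (l : List ℕ) : Prog :=
  .loop i (.cond i .skip (.seq (.pop i) (pushAll l false)) (.seq (.pop i) (pushAll l true)))

/-- Perform the first `J` of the moves `src j ↦ dst j`. -/
def moves (src : ℕ → ℕ) (dst : ℕ → List ℕ) : ℕ → Prog
  | 0 => .skip
  | J + 1 => .seq (moves src dst J) (moveTo (src J) (dst J))

theorem Exec.cast {O : Oracle} {c : Prog} {s : Regs} {T T' : ℕ} {μ μ' : PMF Regs}
    (h : Exec O c s T μ) (hT : T ≤ T') (hμ : μ = μ') : Exec O c s T' μ' :=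
  hμ ▸ h.mono hT

theorem exec_pushAll (O : Oracle) (b : Bool) {l : List ℕ} (hl : l.Nodup) (s : Regs) :
    Exec O (pushAll l b) s (2 * l.length + 1)
      (PMF.pure fun r => if r ∈ l then b :: s r else s r) := by
  induction l generalizing s with
  | nil => simpa [pushAll] using exec_skip O s
  | cons i l ih =>
    obtain ⟨hi, hl⟩ := List.nodup_cons.1 hl
    have := (exec_push O s i b).seq_pure (ih hl _)
    refine this.cast (by simp; omega) ?_
    congr 1
    funext r
    by_cases hr : r = i
    · subst hr; simp [hi]
    · simp [hr]

theorem exec_moveTo (O : Oracle) (i : ℕ) {l : List ℕ} (hl : l.Nodup) (hi : i ∉ l) :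
    ∀ (u : Str) (s : Regs), s i = u → Exec O (moveTo i l) s (u.length * (2 * l.length + 6) + 1)
      (PMF.pure fun r => if r = i then [] else if r ∈ l then u.reverse ++ s r else s r) := by
  intro u
  induction u with
  | nil =>
    intro s hs
    have := exec_loop_nil (O := O)
      (c := .cond i .skip (.seq (.pop i) (pushAll l false)) (.seq (.pop i) (pushAll l true))) hs
    refine this.cast (by simp) ?_
    congr 1
    funext r
    by_cases hr : r = i
    · subst hr; simp [hs]
    · simp [hr]
  | cons b u ih =>
    intro s hs
    have h₁ : Exec O (.seq (.pop i) (pushAll l b)) s _ _ :=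
      (exec_pop O s i).seq_pure (exec_pushAll O b hl _)
    have h₂ : Exec O (.cond i .skip (.seq (.pop i) (pushAll l false))
        (.seq (.pop i) (pushAll l true))) s _ _ :=
      Exec.cond_cons hs (by
        have hb : (if b then Prog.seq (.pop i) (pushAll l true)
            else .seq (.pop i) (pushAll l false)) = .seq (.pop i) (pushAll l b) := by
          cases b <;> rfl
        rw [hb]
        exact h₁)
    have h₃ := Exec.loop_cons (by simp [hs]) h₂ (ih _ (by simp [hi, hs]))
    refine h₃.cast (by simp only [List.length_cons]; ring_nf; omega) ?_
    congr 1
    funext r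
    by_cases hr : r = i
    · subst hr; simp
    · by_cases hr' : r ∈ l <;> simp [hr, hr']

/-- Sources and destinations are disjoint and no register is a destination twice, so the moves do
not interfere. Each move reverses the string; performing two rounds restores the order. -/
theorem exec_moves (O : Oracle) {src : ℕ → ℕ} {dst : ℕ → List ℕ} {n d M : ℕ} {s : Regs}
    (hsrc : src.Injective) (hdst : ∀ j, (dst j).Nodup) (hd : ∀ j, (dst j).length ≤ d)
    (hsd : ∀ j < M, ∀ j' < M, src j ∉ dst j')
    (hdd : ∀ j j' r, r ∈ dst j → r ∈ dst j' → j = j')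
    (hn : ∀ j < M, (s (src j)).length ≤ n) {J : ℕ} (hJM : J ≤ M) :
    ∃ s', Exec O (moves src dst J) s (J * (n * (2 * d + 6) + 2) + 1) (PMF.pure s') ∧
      (∀ j < J, s' (src j) = []) ∧
      (∀ j < J, ∀ r ∈ dst j, s' r = (s (src j)).reverse ++ s r) ∧
      ∀ r, (∀ j < J, r ≠ src j ∧ r ∉ dst j) → s' r = s r := by
  induction J with
  | zero => exact ⟨s, by simpa [moves] using exec_skip O s, by simp, by simp, by simp⟩
  | succ J ih =>
    obtain ⟨s', h₀, h₁, h₂, h₃⟩ := ih (by omega)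
    have hJ : s' (src J) = s (src J) :=
      h₃ _ fun j hj => ⟨hsrc.ne (by omega), hsd J hJM j (by omega)⟩
    refine ⟨_, (h₀.seq_pure (exec_moveTo O (src J) (hdst J) (hsd J hJM J hJM) _ s' rfl)).mono ?_,
      ?_, ?_, ?_⟩
    · have h₄ : (s (src J)).length * (2 * (dst J).length + 6) ≤ n * (2 * d + 6) :=
        Nat.mul_le_mul (hn J hJM) (by have := hd J; omega)
      rw [hJ, Nat.succ_mul J]
      generalize (s (src J)).length * (2 * (dst J).length + 6) = x at *
      generalize n * (2 * d + 6) = z at *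
      omega
    · intro j hj
      rcases Nat.lt_succ_iff_lt_or_eq.1 hj with hj | rfl
      · simp [hsrc.ne hj.ne, hsd j (by omega) J hJM, h₁ j hj]
      · simp
    · intro j hj r hr
      have hrs : r ≠ src J := fun h => hsd J hJM j (by omega) (h ▸ hr)
      rcases Nat.lt_succ_iff_lt_or_eq.1 hj with hj | rfl
      · have hrJ : r ∉ dst J := fun h => hj.ne (hdd _ _ _ hr h)
        simp [hrs, hrJ, h₂ j hj r hr]
      · have hr' : s' r = s r := h₃ r fun j' hj' =>
          ⟨fun h => hsd j' (by omega) j hJM (h ▸ hr), fun h => hj'.ne (hdd _ _ _ h hr)⟩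
        simp [hrs, hr, hr', hJ]
    · intro r hr
      have := hr J (by omega)
      simp [this.1, this.2, h₃ r fun j hj => hr j (by omega)]

/-! ### Efficient algorithms -/

/-- A class of programs closed under the constructions used below. -/
class ProgClass (P : Prog → Prop) : Prop where
  skip : P .skip
  push : ∀ i b, P (.push i b)
  pop : ∀ i, P (.pop i)
  seq : ∀ {c d}, P c → P d → P (.seq c d)
  cond : ∀ {i c c₀ c₁}, P c → P c₀ → P c₁ → P (.cond i c c₀ c₁)
  loop : ∀ {i c}, P c → P (.loop i c)
  rename : ∀ {c} (e : ℕ → ℕ), P c → P (c.rename e)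

theorem Prog.OracleFree.rename {c : Prog} (e : ℕ → ℕ) (h : c.OracleFree) :
    (c.rename e).OracleFree := by
  induction c with
  | query => exact h.elim
  | seq c d hc hd => exact ⟨hc h.1, hd h.2⟩
  | cond i c c₀ c₁ hc h₀ h₁ => exact ⟨hc h.1, h₀ h.2.1, h₁ h.2.2⟩
  | loop i c hc => exact hc h
  | _ => trivial

theorem Prog.CoinFree.rename {c : Prog} (e : ℕ → ℕ) (h : c.CoinFree) :
    (c.rename e).CoinFree := by
  induction c with
  | flip => exact h.elim
  | seq c d hc hd => exact ⟨hc h.1, hd h.2⟩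
  | cond i c c₀ c₁ hc h₀ h₁ => exact ⟨hc h.1, h₀ h.2.1, h₁ h.2.2⟩
  | loop i c hc => exact hc h
  | _ => trivial

/-- The programs of deterministic algorithms. -/
def Deterministic (c : Prog) : Prop := c.OracleFree ∧ c.CoinFree

/-- All programs. -/
def AnyProg (_ : Prog) : Prop := True

instance : ProgClass Prog.OracleFree where
  skip := trivial
  push _ _ := trivial
  pop _ := trivial
  seq hc hd := ⟨hc, hd⟩
  cond hc h₀ h₁ := ⟨hc, h₀, h₁⟩
  loop hc := hc
  rename e h := h.rename e

instance : ProgClass Deterministic where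
  skip := ⟨trivial, trivial⟩
  push _ _ := ⟨trivial, trivial⟩
  pop _ := ⟨trivial, trivial⟩
  seq hc hd := ⟨⟨hc.1, hd.1⟩, hc.2, hd.2⟩
  cond hc h₀ h₁ := ⟨⟨hc.1, h₀.1, h₁.1⟩, hc.2, h₀.2, h₁.2⟩
  loop hc := hc
  rename e h := ⟨h.1.rename e, h.2.rename e⟩

instance : ProgClass AnyProg where
  skip := trivial
  push _ _ := trivial
  pop _ := trivial
  seq _ _ := trivial
  cond _ _ _ := trivial
  loop _ := trivial
  rename _ _ := trivial

theorem ProgClass.pushAll {P : Prog → Prop} [ProgClass P] (l : List ℕ) (b : Bool) :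
    P (pushAll l b) := by
  induction l with
  | nil => exact ProgClass.skip
  | cons r l ih => exact ProgClass.seq (ProgClass.push r b) ih

theorem ProgClass.moveTo {P : Prog → Prop} [ProgClass P] (i : ℕ) (l : List ℕ) :
    P (moveTo i l) :=
  ProgClass.loop (ProgClass.cond ProgClass.skip
    (ProgClass.seq (ProgClass.pop i) (ProgClass.pushAll l false))
    (ProgClass.seq (ProgClass.pop i) (ProgClass.pushAll l true)))

theorem ProgClass.moves {P : Prog → Prop} [ProgClass P] (src : ℕ → ℕ) (dst : ℕ → List ℕ) (J : ℕ) :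
    P (moves src dst J) := by
  induction J with
  | zero => exact ProgClass.skip
  | succ J ih => exact ProgClass.seq ih (ProgClass.moveTo _ _)

/-- `F O a` is the output distribution, on input `a` and with access to `O`, of an algorithm in the
class `P` with running time and output length polynomial in the input length. -/
def Efficient (P : Prog → Prop) {k : ℕ} (F : Oracle → (Fin k → Str) → PMF Str) : Prop :=
  ∃ (c : Prog) (q : Polynomial ℕ), P c ∧ ∀ (O : Oracle) (a : Fin k → Str),
    c.OutputsWithin outStr O a (q.eval (inputLength a)) (F O a) ∧
      ∀ y ∈ (F O a).support, y.length ≤ q.eval (inputLength a)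

/-- A deterministic polynomial-time function, as an algorithm in the class `P`. -/
abbrev EfficientFun (P : Prog → Prop) {k : ℕ} (f : (Fin k → Str) → Str) : Prop :=
  Efficient P fun _ a => PMF.pure (f a)

theorem Efficient.mono {P P' : Prog → Prop} (hP : ∀ c, P c → P' c) {k : ℕ}
    {F : Oracle → (Fin k → Str) → PMF Str} (h : Efficient P F) : Efficient P' F := by
  obtain ⟨c, q, hc, h⟩ := h
  exact ⟨c, q, hP c hc, h⟩

theorem eval_mono (q : Polynomial ℕ) {m n : ℕ} (h : m ≤ n) : q.eval m ≤ q.eval n := by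
  rw [Polynomial.eval_eq_sum, Polynomial.eval_eq_sum]
  exact Finset.sum_le_sum fun i _ => Nat.mul_le_mul_left _ (Nat.pow_le_pow_left h i)

theorem length_le_inputLength {k : ℕ} (a : Fin k → Str) (i : Fin k) :
    (a i).length ≤ inputLength a :=
  Finset.single_le_sum (f := fun i => (a i).length) (fun _ _ => Nat.zero_le _) (Finset.mem_univ i)

theorem length_startRegs_le {k : ℕ} (a : Fin k → Str) (i : ℕ) :
    (startRegs a i).length ≤ inputLength a := by
  unfold startRegs
  split_ifs
  · exact length_le_inputLength a _
  · simp

/-- The output of an oracle-free program is no longer than its input plus its running time. -/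
theorem outputsWithin_length_le {c : Prog} (hc : c.OracleFree) {O : Oracle} {k : ℕ}
    {a : Fin k → Str} {T : ℕ} {u : Regs}
    (hu : u ∈ ((run O T (start c a)).map Config.regs).support) (i : ℕ) :
    (u i).length ≤ inputLength a + T := by
  obtain ⟨γ, hγ, rfl⟩ := (PMF.mem_support_map_iff _ _ _).1 hu
  refine (run_length_le T (by simpa [start] using hc) hγ i).trans ?_
  exact Nat.add_le_add_right (length_startRegs_le a i) T

/-- Oracle-free registers grow by at most one symbol per step, so adding `X` to the time bound also
bounds the output length. The conclusion concerns the raw content of register `0`, whatever `out`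
reads. -/
theorem Efficient.of_outputsWithin {P : Prog → Prop} {β : Type} {out : Regs → β} {k : ℕ}
    {F : Oracle → (Fin k → Str) → PMF β} {c : Prog} {q : Polynomial ℕ} (hP : P c)
    (hc : c.OracleFree) (h : ∀ O a, c.OutputsWithin out O a (q.eval (inputLength a)) (F O a)) :
    Efficient P fun O (a : Fin k → Str) =>
      (run O (q.eval (inputLength a)) (start c a)).map fun γ => outStr γ.regs := by
  refine ⟨c, q + Polynomial.X, hP, fun O a => ?_⟩
  have hle : q.eval (inputLength a) ≤ (q + Polynomial.X).eval (inputLength a) := by simp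
  refine ⟨?_, fun y hy => ?_⟩
  · have h₁ : Halts O (start c a) (q.eval (inputLength a)) (q.eval (inputLength a))
        ((run O (q.eval (inputLength a)) (start c a)).map Config.regs) := ⟨(h O a).1, rfl⟩
    have h₂ := h₁.mono hle
    refine ⟨fun γ hγ => ⟨(h₂.1 γ hγ).1, (h₂.1 γ hγ).2.trans hle⟩, ?_⟩
    have := congrArg (PMF.map outStr) h₂.2
    rw [PMF.map_comp, PMF.map_comp] at this
    exact this.trans rfl
  · obtain ⟨γ, hγ, rfl⟩ := (PMF.mem_support_map_iff _ _ _).1 hy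
    have := outputsWithin_length_le (u := γ.regs) hc ((PMF.mem_support_map_iff _ _ _).2 ⟨γ, hγ, rfl⟩) 0
    simp only [Polynomial.eval_add, Polynomial.eval_X]
    unfold outStr
    omega

theorem Efficient.of_exec {P : Prog → Prop} {k : ℕ} {F : Oracle → (Fin k → Str) → PMF Str}
    {c : Prog} (q : Polynomial ℕ) (hP : P c)
    (h : ∀ O a, ∃ μ, Exec O c (startRegs a) (q.eval (inputLength a)) μ ∧ μ.map outStr = F O a ∧
      ∀ y ∈ (F O a).support, y.length ≤ q.eval (inputLength a)) :
    Efficient P F := by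
  refine ⟨c, q, hP, fun O a => ?_⟩
  obtain ⟨μ, h₁, h₂, h₃⟩ := h O a
  exact ⟨h₂ ▸ h₁.outputsWithin, h₃⟩

/-- Run an algorithm on some of the inputs, and then another one on its output and all the
inputs. -/
theorem Efficient.bind {P : Prog → Prop} [ProgClass P] {k m : ℕ}
    {F : Oracle → (Fin k → Str) → PMF Str} {G : Oracle → (Fin (m + 1) → Str) → PMF Str}
    (hF : Efficient P F) (σ : Fin k → Fin m) (hG : Efficient P G) :
    Efficient P fun O (a : Fin m → Str) =>
      (F O fun i => a (σ i)).bind fun y => G O (Fin.cons y a : Fin (m + 1) → Str) := by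
  obtain ⟨c, qc, hPc, hc⟩ := hF
  obtain ⟨d, qd, hPd, hd⟩ := hG
  -- Register layout modulo 4: `c` runs in the class of 1, `d` in the class of 0, and the class of 2
  -- is scratch space for the inputs. Input `j` goes to `4 * (j + 1)`, leaving `0` free for `y`, and
  -- to every `4 * i + 1` with `σ i = j`. Passing through `tmp` cancels the reversal.
  set src₁ : ℕ → ℕ := fun j => j with hsrc₁
  set tmp : ℕ → ℕ := fun j => 4 * (m + j) + 2 with htmp
  set dst : ℕ → List ℕ := fun j => 4 * (j + 1) ::
    ((List.finRange k).filter fun i => (σ i : ℕ) = j).map fun i : Fin k => 4 * (i : ℕ) + 1 with hdst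
  set prog : Prog := .seq (moves src₁ (fun j => [tmp j]) m) <| .seq (moves tmp dst m) <|
    .seq (c.rename fun i => 4 * i + 1) <| .seq (moveTo 1 [3]) <| .seq (moveTo 3 [0])
      (d.rename fun i => 4 * i) with hprog
  -- `σ` may repeat inputs, so the input of `c` can be up to `k` times as long. `QF` bounds the time
  -- and the output of `c`, and `QG` those of `d` on the input extended by that output.
  set QF : Polynomial ℕ := qc.comp (Polynomial.C k * Polynomial.X) with hQF
  set QG : Polynomial ℕ := qd.comp (Polynomial.X + QF) with hQG
  set q : Polynomial ℕ := Polynomial.C m * (Polynomial.X * Polynomial.C (2 * 1 + 6) + Polynomial.C 2) +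
    Polynomial.C m * (Polynomial.X * Polynomial.C (2 * (k + 1) + 6) + Polynomial.C 2) + QF +
    Polynomial.C 16 * QF + QG + Polynomial.C 20 with hq
  have hn₁ : ∀ (a : Fin m → Str), inputLength (fun i => a (σ i)) ≤ k * inputLength a := fun a => by
    refine (Finset.sum_le_card_nsmul Finset.univ _ (inputLength a) fun i _ =>
      length_le_inputLength a (σ i)).trans ?_
    simp
  have hyF : ∀ O (a : Fin m → Str), ∀ y ∈ (F O fun i => a (σ i)).support,
      y.length ≤ QF.eval (inputLength a) := fun O a y hy => by
    refine ((hc O _).2 y hy).trans ?_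
    simpa [hQF] using eval_mono qc (hn₁ a)
  have hnG : ∀ (a : Fin m → Str) (y : Str), y.length ≤ QF.eval (inputLength a) →
      qd.eval (inputLength (Fin.cons y a : Fin (m + 1) → Str)) ≤ QG.eval (inputLength a) := by
    intro a y hy
    simp only [hQG, Polynomial.eval_comp, Polynomial.eval_add, Polynomial.eval_X]
    refine eval_mono qd ?_
    simp only [inputLength, Fin.sum_univ_succ, Fin.cons_zero, Fin.cons_succ]
    unfold inputLength at hy
    omega
  refine Efficient.of_exec (c := prog) q ?_ ?_
  · exact ProgClass.seq (ProgClass.moves _ _ _) <| ProgClass.seq (ProgClass.moves _ _ _) <|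
      ProgClass.seq (ProgClass.rename _ hPc) <| ProgClass.seq (ProgClass.moveTo _ _) <|
      ProgClass.seq (ProgClass.moveTo _ _) (ProgClass.rename _ hPd)
  intro O a
  set n := inputLength a with hn
  have hst : ∀ j, m ≤ j → startRegs a j = [] := fun j hj => by simp [startRegs, hj]
  have htmpinj : tmp.Injective := fun i j h => by simp only [htmp] at h; omega
  have hmem : ∀ j r, r ∈ dst j ↔ r = 4 * (j + 1) ∨ ∃ i : Fin k, (σ i : ℕ) = j ∧ 4 * (i : ℕ) + 1 = r := by
    intro j r
    simp [hdst]
  have htd : ∀ j j', tmp j ∉ dst j' := by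
    intro j j' h
    simp only [hmem, htmp] at h
    rcases h with h | ⟨i, -, h⟩ <;> omega
  obtain ⟨s₁, e₁, f₁, g₁, k₁⟩ := exec_moves O (src := src₁) (dst := fun j => [tmp j])
    (M := m) (n := n) (d := 1) (s := startRegs a) (fun _ _ h => h) (by simp) (by simp)
    (by intro j hj j' hj'; simp only [hsrc₁, htmp, List.mem_singleton]; omega)
    (by intro j j' r h h'; simp only [List.mem_singleton] at h h'; exact htmpinj (h.symm.trans h'))
    (fun j _ => length_startRegs_le a j) le_rfl
  have A₁ : ∀ j < m, s₁ (tmp j) = (startRegs a j).reverse := fun j hj => by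
    have := g₁ j hj (tmp j) (by simp)
    rwa [hst (tmp j) (by simp only [htmp]; omega), List.append_nil] at this
  have A₂ : ∀ r, (∀ j < m, r ≠ tmp j) → s₁ r = [] := fun r hr => by
    by_cases hrm : r < m
    · exact f₁ r hrm
    · rw [k₁ r fun j hj => ⟨by simp only [hsrc₁]; omega, by simpa using hr j hj⟩]
      exact hst r (by omega)
  have A₃ : ∀ j j', ∀ r ∈ dst j, r ≠ tmp j' := fun j j' r hr h => htd j' j (h ▸ hr)
  obtain ⟨s₂, e₂, -, g₂, k₂⟩ := exec_moves O (src := tmp) (dst := dst) (M := m)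
    (n := n) (d := k + 1) (s := s₁) htmpinj
    (by
      intro j
      simp only [hdst, List.nodup_cons, List.mem_map, not_exists, not_and]
      refine ⟨fun i _ => by omega, List.Nodup.map (fun i j h => Fin.ext (by simpa using h))
        ((List.nodup_finRange k).filter _)⟩)
    (by
      intro j
      simp only [hdst, List.length_cons, List.length_map]
      have := List.length_filter_le (fun i => decide ((σ i : ℕ) = j)) (List.finRange k)
      simp only [List.length_finRange] at this
      omega)
    (fun j _ j' _ => htd j j')
    (by
      intro j j' r h h'
      rw [hmem] at h h'
      rcases h with h | ⟨i, hi, h⟩ <;> rcases h' with h' | ⟨i', hi', h'⟩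
      · omega
      · omega
      · omega
      · obtain rfl : i = i' := Fin.ext (by omega)
        omega)
    (by
      intro j hj
      rw [A₁ j hj, List.length_reverse]
      exact length_startRegs_le a j) le_rfl
  have B₁ : ∀ j < m, ∀ r ∈ dst j, s₂ r = startRegs a j := fun j hj r hr => by
    rw [g₂ j hj r hr, A₁ j hj, A₂ r fun j' _ => A₃ j j' r hr]
    simp
  have B₂ : ∀ r, r % 4 ≠ 2 → (∀ j < m, r ∉ dst j) → s₂ r = [] := fun r hr hr' => by
    have : ∀ j < m, r ≠ tmp j := fun j _ => by simp only [htmp]; omega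
    rw [k₂ r fun j hj => ⟨this j hj, hr' j hj⟩, A₂ r this]
  have C₁ : ∀ i, s₂ (4 * i + 1) = startRegs (fun i => a (σ i)) i := by
    intro i
    by_cases hi : i < k
    · rw [B₁ (σ ⟨i, hi⟩) (σ ⟨i, hi⟩).2 _ ((hmem _ _).2 (Or.inr ⟨⟨i, hi⟩, rfl, rfl⟩))]
      simp [startRegs, hi]
    · rw [B₂ _ (by omega)]
      · simp [startRegs, hi]
      · intro j _ h
        rcases (hmem _ _).1 h with h | ⟨i', -, h⟩ <;> omega
  have C₂ : ∀ i, s₂ (4 * (i + 1)) = startRegs a i := by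
    intro i
    by_cases hi : i < m
    · exact B₁ i hi _ ((hmem _ _).2 (Or.inl rfl))
    · rw [B₂ _ (by omega), hst i (by omega)]
      intro j _ h
      rcases (hmem _ _).1 h with h | ⟨i', -, h⟩ <;> omega
  have C₃ : ∀ r, r % 4 = 3 ∨ r = 0 → s₂ r = [] := fun r hr => B₂ r (by omega) fun j _ h => by
    rcases (hmem _ _).1 h with h | ⟨i', -, h⟩ <;> omega
  have hinj₁ : Function.Injective fun i : ℕ => 4 * i + 1 := fun i j h => by
    simp only at h; omega
  have hinj₀ : Function.Injective fun i : ℕ => 4 * i := fun i j h => by simp only at h; omega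
  have e₃ := (hc O fun i => a (σ i)).1.exec hinj₁ C₁
  set μc := (run O (qc.eval (inputLength fun i => a (σ i))) (start c fun i => a (σ i))).map
    Config.regs with hμc
  have hμcF : μc.map outStr = F O fun i => a (σ i) := by
    rw [← (hc O fun i => a (σ i)).1.2, hμc, PMF.map_comp]
    rfl
  set μd : Str → PMF Regs := fun y => (run O (qd.eval (inputLength (Fin.cons y a : Fin (m + 1) → Str)))
    (start d (Fin.cons y a : Fin (m + 1) → Str))).map Config.regs with hμd
  have hμdG : ∀ y, (μd y).map outStr = G O (Fin.cons y a : Fin (m + 1) → Str) := fun y => by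
    rw [← (hd O (Fin.cons y a)).1.2, hμd, PMF.map_comp]
    rfl
  -- The registers when `d` starts: the output of `c` has gone from `1` to `0` through `3`, again
  -- with two reversals. What else `c` left behind lies in the class of 1, which `d` never touches.
  set S : Regs → Regs := fun s₃ r =>
    if r = 1 ∨ r = 3 then [] else if r = 0 then s₃ 1 else s₃ r with hS
  have e₄ : ∀ s₃ ∈ (μc.map fun u => Function.extend (fun i => 4 * i + 1) u s₂).support,
      Exec O (.seq (moveTo 1 [3]) (.seq (moveTo 3 [0]) (d.rename fun i => 4 * i))) s₃
        (16 * QF.eval n + QG.eval n + 4)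
        ((μd (s₃ 1)).map fun u => Function.extend (fun i => 4 * i) u (S s₃)) := by
    intro s₃ hs₃
    obtain ⟨u, hu, rfl⟩ := (PMF.mem_support_map_iff _ _ _).1 hs₃
    have h1 : Function.extend (fun i => 4 * i + 1) u s₂ 1 = u 0 := hinj₁.extend_apply u s₂ 0
    have hne : ∀ r, r % 4 ≠ 1 → Function.extend (fun i => 4 * i + 1) u s₂ r = s₂ r :=
      fun r hr => Function.extend_apply' _ _ _ (by rintro ⟨i, rfl⟩; omega)
    set s₃ := Function.extend (fun i => 4 * i + 1) u s₂ with hs₃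
    have hlen : (s₃ 1).length ≤ QF.eval n := by
      rw [h1]
      refine hyF O a _ ?_
      rw [← hμcF]
      exact (PMF.mem_support_map_iff _ _ _).2 ⟨u, hu, rfl⟩
    have m₁ := exec_moveTo O 1 (l := [3]) (by simp) (by simp) _ s₃ rfl
    have m₂ := exec_moveTo O 3 (l := [0]) (by simp) (by simp) (s₃ 1).reverse
      (fun r => if r = 1 then [] else if r ∈ [3] then (s₃ 1).reverse ++ s₃ r else s₃ r)
      (by simp [hne 3 (by omega), C₃ 3 (by omega)])
    have hSeq : (fun r => if r = 3 then [] else if r ∈ [0] then (s₃ 1).reverse.reverse ++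
        (if r = 1 then [] else if r ∈ [3] then (s₃ 1).reverse ++ s₃ r else s₃ r) else
        (if r = 1 then [] else if r ∈ [3] then (s₃ 1).reverse ++ s₃ r else s₃ r)) = S s₃ := by
      funext r
      by_cases h3 : r = 3
      · simp [hS, h3]
      by_cases h0 : r = 0
      · simp [hS, h0, hne 0 (by omega), C₃ 0 (by omega)]
      · by_cases h1 : r = 1 <;> simp [hS, h3, h0, h1]
    rw [hSeq] at m₂
    have m₃ := (hd O (Fin.cons (s₃ 1) a)).1.exec (s := S s₃) hinj₀ (by
      rintro (_ | i)
      · simp [hS, startRegs]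
      · have : S s₃ (4 * (i + 1)) = s₃ (4 * (i + 1)) := by
          simp only [hS]
          rw [if_neg (by omega), if_neg (by omega)]
        rw [this, hne _ (by omega), C₂]
        by_cases hi : i < m
        · simp only [startRegs, hi, Nat.succ_lt_succ_iff, dite_true]
          rfl
        · simp [startRegs, hi])
    refine (m₁.seq_pure (m₂.seq_pure m₃)).mono ?_
    have : _ ≤ QG.eval n := hnG a _ hlen
    simp only [List.length_reverse, List.length_singleton]
    omega
  refine ⟨_, (e₁.seq_pure (e₂.seq_pure (e₃.seq e₄))).mono ?_, ?_, ?_⟩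
  · have : qc.eval (inputLength fun i => a (σ i)) ≤ QF.eval n := by
      simpa [hQF] using eval_mono qc (hn₁ a)
    simp only [hq, Polynomial.eval_add, Polynomial.eval_mul, Polynomial.eval_C, Polynomial.eval_X]
    omega
  · clear_value μc μd
    rw [PMF.map_bind, PMF.bind_map, ← hμcF, PMF.bind_map]
    refine congrArg (PMF.bind μc) (funext fun u => ?_)
    have h1 : Function.extend (fun i => 4 * i + 1) u s₂ 1 = u 0 := hinj₁.extend_apply u s₂ 0
    simp only [Function.comp_apply, h1, PMF.map_comp]
    rw [← hμdG (outStr u)]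
    exact congrArg (fun g => PMF.map g (μd (outStr u)))
      (funext fun v => hinj₀.extend_apply v (S (Function.extend (fun i => 4 * i + 1) u s₂)) 0)
  · intro z hz
    obtain ⟨y, hy, hz⟩ := (PMF.mem_support_bind_iff _ _ _).1 hz
    have h₁ := (hd O _).2 z hz
    have h₂ : _ ≤ QG.eval n := hnG a y (hyF O a y hy)
    simp only [hq, Polynomial.eval_add]
    omega

/-! ### Basic algorithms -/

section Basic

variable {P : Prog → Prop} [ProgClass P]

theorem EfficientFun.of_exec {P : Prog → Prop} {k : ℕ} {f : (Fin k → Str) → Str} {c : Prog}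
    (q : Polynomial ℕ) (hP : P c)
    (h : ∀ O a, ∃ s', Exec O c (startRegs a) (q.eval (inputLength a)) (PMF.pure s') ∧
      s' 0 = f a ∧ (f a).length ≤ q.eval (inputLength a)) : EfficientFun P f := by
  refine Efficient.of_exec q hP fun O a => ?_
  obtain ⟨s', h₁, h₂, h₃⟩ := h O a
  refine ⟨_, h₁, ?_, ?_⟩
  · rw [PMF.pure_map, outStr, h₂]
  · simpa using h₃

variable (P) in
theorem efficientFun_head (m : ℕ) : EfficientFun P fun a : Fin (m + 1) → Str => a 0 :=
  EfficientFun.of_exec (c := .skip) (Polynomial.X + 1) ProgClass.skip fun O a =>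
    ⟨_, (exec_skip O _).mono (by simp), by simp [startRegs], by
      have := length_le_inputLength a 0
      simp; omega⟩

variable (P) in
theorem efficientFun_cons (b : Bool) : EfficientFun P fun a : Fin 1 → Str => b :: a 0 :=
  EfficientFun.of_exec (c := .push 0 b) (Polynomial.X + 1) (ProgClass.push 0 b) fun O a =>
    ⟨_, (exec_push O _ 0 b).mono (by simp), by simp [startRegs], by
      have := length_le_inputLength a 0
      simp; omega⟩

variable (P) in
theorem efficientFun_true : EfficientFun P fun _ : Fin 0 → Str => [true] :=
  EfficientFun.of_exec (c := .push 0 true) 1 (ProgClass.push 0 true) fun O a =>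
    ⟨_, (exec_push O _ 0 true).mono (by simp), by simp [startRegs], by simp⟩

/-- Prepend a verdict, given as a string. -/
def consBit (u v : Str) : Str := match v with
  | [] => u
  | b :: _ => b :: u

variable (P) in
theorem efficientFun_consBit : EfficientFun P fun a : Fin 2 → Str => consBit (a 0) (a 1) := by
  refine EfficientFun.of_exec (c := .cond 1 .skip (.push 0 false) (.push 0 true)) (Polynomial.X + 2)
    (ProgClass.cond ProgClass.skip (ProgClass.push _ _) (ProgClass.push _ _)) fun O a => ?_
  have h₀ : startRegs a 0 = a 0 := rfl
  have h₁ : startRegs a 1 = a 1 := rfl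
  have hl := length_le_inputLength a 0
  rcases h : a 1 with _ | ⟨b, l⟩
  · exact ⟨_, (Exec.cond_nil (h₁.trans h) (exec_skip O _)).mono (by simp), by simp [h₀, consBit],
      by simp [consBit]; omega⟩
  · refine ⟨_, (Exec.cond_cons (h₁.trans h) (μ := PMF.pure (Function.update (startRegs a) 0 (b :: a 0)))
      (T := 1) ?_).mono (by simp), by simp [consBit], by simp [consBit]; omega⟩
    cases b <;> exact exec_push O _ _ _

/-- Conjunction of two verdicts, given as strings. -/
def andBit (u v : Str) : Str := match v with
  | [] => u
  | false :: _ => false :: u.tail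
  | true :: _ => u

variable (P) in
theorem efficientFun_andBit : EfficientFun P fun a : Fin 2 → Str => andBit (a 0) (a 1) := by
  refine EfficientFun.of_exec (c := .cond 1 .skip (.seq (.pop 0) (.push 0 false)) .skip)
    (Polynomial.X + 4) (ProgClass.cond ProgClass.skip
      (ProgClass.seq (ProgClass.pop _) (ProgClass.push _ _)) ProgClass.skip) fun O a => ?_
  have h₀ : startRegs a 0 = a 0 := rfl
  have h₁ : startRegs a 1 = a 1 := rfl
  have hl := length_le_inputLength a 0
  rcases h : a 1 with _ | ⟨_ | _, l⟩
  · exact ⟨_, (Exec.cond_nil (h₁.trans h) (exec_skip O _)).mono (by simp), by simp [h₀, andBit],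
      by simp [andBit]; omega⟩
  · exact ⟨_, (Exec.cond_cons (h₁.trans h) ((exec_pop O _ 0).seq_pure (exec_push O _ 0 false))).mono
      (by simp), by simp [h₀, andBit], by simp [andBit]; omega⟩
  · exact ⟨_, (Exec.cond_cons (h₁.trans h) (exec_skip O _)).mono (by simp), by simp [h₀, andBit],
      by simp [andBit]; omega⟩

theorem exec_loop_unary (O : Oracle) : ∀ (u : Str) (s : Regs), s 0 = u → ∃ s',
    Exec O (.loop 0 (.seq (.pop 0) (.push 1 true))) s (4 * u.length + 1) (PMF.pure s') ∧
      s' 0 = [] ∧ s' 1 = unary u.length ++ s 1 := by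
  intro u
  induction u with
  | nil => exact fun s hs => ⟨s, exec_loop_nil hs, hs, by simp [unary]⟩
  | cons b u ih =>
    intro s hs
    have h₁ := (exec_pop O s 0).seq_pure (exec_push O _ 1 true)
    obtain ⟨s', h₂, h₃, h₄⟩ := ih _ (show Function.update (Function.update s 0 (s 0).tail) 1 _ 0 = u by
      simp [hs])
    refine ⟨s', (Exec.loop_cons (by simp [hs]) h₁ h₂).mono (by simp; omega), h₃, ?_⟩
    rw [h₄]
    simp [unary, List.replicate_succ']

variable (P) in
theorem efficientFun_unary : EfficientFun P fun a : Fin 1 → Str => unary (a 0).length := by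
  refine EfficientFun.of_exec (c := .seq (.loop 0 (.seq (.pop 0) (.push 1 true))) (moveTo 1 [0]))
    (12 * Polynomial.X + 3) (ProgClass.seq (ProgClass.loop (ProgClass.seq (ProgClass.pop _)
      (ProgClass.push _ _))) (ProgClass.moveTo _ _)) fun O a => ?_
  have hl := length_le_inputLength a 0
  obtain ⟨s', h₁, h₂, h₃⟩ := exec_loop_unary O (a 0) (startRegs a) rfl
  have h₄ : s' 1 = unary (a 0).length := by simpa [startRegs] using h₃
  refine ⟨_, (h₁.seq_pure (exec_moveTo O 1 (l := [0]) (by simp) (by simp) _ s' h₄)).mono ?_, ?_, ?_⟩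
  · simp [unary]; omega
  · simp [unary, h₂]
  · simp [unary]; omega

/-- Compare the contents of registers `0` and `1`; the register `2` tells whether they still
agree. -/
def compareLoop : Prog := .loop 0 (.cond 0 .skip
  (.seq (.pop 0) (.cond 1 (.pop 2) (.pop 1) (.seq (.pop 1) (.pop 2))))
  (.seq (.pop 0) (.cond 1 (.pop 2) (.seq (.pop 1) (.pop 2)) (.pop 1))))

/-- The invariant is whether the flag is set and the remaining strings are equal. A cleared flag
stays cleared, since popping an empty register has no effect. -/
theorem exec_compareLoop (O : Oracle) : ∀ (u : Str) (s : Regs), s 0 = u →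
    (s 2 = [true] ∨ s 2 = []) → ∃ s', Exec O compareLoop s (8 * u.length + 1) (PMF.pure s') ∧
      s' 0 = [] ∧ (s' 2 = [true] ∨ s' 2 = []) ∧
      (s' 2 = [true] ∧ s' 1 = [] ↔ s 2 = [true] ∧ u = s 1) := by
  intro u
  induction u with
  | nil =>
    intro s hs hf
    exact ⟨s, exec_loop_nil hs, hs, hf, and_congr_right' eq_comm⟩
  | cons b u ih =>
    intro s hs hf
    suffices h : ∃ s₁, Exec O (.cond 0 .skip
        (.seq (.pop 0) (.cond 1 (.pop 2) (.pop 1) (.seq (.pop 1) (.pop 2))))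
        (.seq (.pop 0) (.cond 1 (.pop 2) (.seq (.pop 1) (.pop 2)) (.pop 1)))) s 7 (PMF.pure s₁) ∧
        s₁ 0 = u ∧ (s₁ 2 = [true] ∨ s₁ 2 = []) ∧
        (s₁ 2 = [true] ∧ u = s₁ 1 ↔ s 2 = [true] ∧ b :: u = s 1) by
      obtain ⟨s₁, h₁, h₂, h₃, h₄⟩ := h
      obtain ⟨s', h₅, h₆, h₇, h₈⟩ := ih s₁ h₂ h₃
      exact ⟨s', (Exec.loop_cons (by simp [hs]) h₁ h₅).mono (by simp; omega), h₆, h₇, h₈.trans h₄⟩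
    have hp := exec_pop O s 0
    set s₀ := Function.update s 0 (s 0).tail with hs₀
    have h0 : s₀ 0 = u := by simp [hs₀, hs]
    have h1 : s₀ 1 = s 1 := by simp [hs₀]
    have h2 : s₀ 2 = s 2 := by simp [hs₀]
    rcases h : s 1 with _ | ⟨b', l⟩
    · refine ⟨Function.update s₀ 2 (s₀ 2).tail, ?_, by simp [h0], ?_, ?_⟩
      · have : ∀ d e, Exec O (.cond 1 (.pop 2) d e) s₀ 2 _ := fun d e =>
          Exec.cond_nil (h1.trans h) (exec_pop O s₀ 2)
        refine (Exec.cond_cons hs (T := 4) ?_).mono (by omega)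
        cases b
        · exact hp.seq_pure (this _ _)
        · exact hp.seq_pure (this _ _)
      · rcases hf with hf | hf <;> simp [h2, hf]
      · rcases hf with hf | hf <;> simp [h2, hf]
    · by_cases hb : b' = b
      · subst hb
        refine ⟨Function.update s₀ 1 (s₀ 1).tail, ?_, by simp [h0], by simpa [h2] using hf,
          by simp [h1, h2, h]⟩
        refine (Exec.cond_cons hs (T := 4) ?_).mono (by omega)
        cases b'
        · exact hp.seq_pure (Exec.cond_cons (h1.trans h) (T := 1) (exec_pop O s₀ 1))
        · exact hp.seq_pure (Exec.cond_cons (h1.trans h) (T := 1) (exec_pop O s₀ 1))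
      · obtain ⟨s₁, hq, q₀, q₂⟩ : ∃ s₁, Exec O (.seq (.pop 1) (.pop 2)) s₀ 3 (PMF.pure s₁) ∧
            s₁ 0 = u ∧ s₁ 2 = [] :=
          ⟨_, (exec_pop O s₀ 1).seq_pure (exec_pop O _ 2), by simp [h0], by
            rcases hf with hf | hf <;> simp [h2, hf]⟩
        refine ⟨s₁, ?_, q₀, Or.inr q₂, by simp [q₂, Ne.symm hb]⟩
        refine (Exec.cond_cons hs (T := 6) ?_).mono (by omega)
        cases b
        · obtain rfl : b' = true := by simpa using hb
          exact hp.seq_pure (Exec.cond_cons (h1.trans h) (T := 3) hq)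
        · obtain rfl : b' = false := by simpa using hb
          exact hp.seq_pure (Exec.cond_cons (h1.trans h) (T := 3) hq)

variable (P) in
theorem efficientFun_eq : EfficientFun P fun a : Fin 2 → Str => [decide (a 0 = a 1)] := by
  -- The loop stops when register `0` is empty, so a leftover in register `1` must still clear the
  -- flag afterwards.
  refine EfficientFun.of_exec (c := .seq (.push 2 true) (.seq compareLoop
    (.seq (.cond 1 .skip (.pop 2) (.pop 2)) (.cond 2 (.push 0 false) .skip (.push 0 true)))))
    (8 * Polynomial.X + 10) ?_ fun O a => ?_
  · exact ProgClass.seq (ProgClass.push _ _) <| ProgClass.seq (ProgClass.loop (ProgClass.cond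
      ProgClass.skip (ProgClass.seq (ProgClass.pop _) (ProgClass.cond (ProgClass.pop _)
      (ProgClass.pop _) (ProgClass.seq (ProgClass.pop _) (ProgClass.pop _))))
      (ProgClass.seq (ProgClass.pop _) (ProgClass.cond (ProgClass.pop _)
      (ProgClass.seq (ProgClass.pop _) (ProgClass.pop _)) (ProgClass.pop _))))) <|
      ProgClass.seq (ProgClass.cond ProgClass.skip (ProgClass.pop _) (ProgClass.pop _))
      (ProgClass.cond (ProgClass.push _ _) ProgClass.skip (ProgClass.push _ _))
  have hl := length_le_inputLength a 0
  have e₀ := exec_push O (startRegs a) 2 true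
  set s := Function.update (startRegs a) 2 (true :: startRegs a 2) with hs
  have h0 : s 0 = a 0 := rfl
  have h1 : s 1 = a 1 := rfl
  have h2 : s 2 = [true] := rfl
  obtain ⟨s', e₁, f₀, f₂, f₃⟩ := exec_compareLoop O (a 0) s h0 (Or.inl h2)
  simp only [h1, h2, true_and] at f₃
  obtain ⟨s'', e₂, g₀, g₂⟩ : ∃ s'', Exec O (.cond 1 .skip (.pop 2) (.pop 2)) s' 2 (PMF.pure s'') ∧
      s'' 0 = [] ∧ s'' 2 = if a 0 = a 1 then [true] else [] := by
    rcases h : s' 1 with _ | ⟨b, l⟩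
    · refine ⟨s', Exec.cond_nil h (exec_skip O s'), f₀, ?_⟩
      rw [← if_congr f₃ rfl rfl]
      rcases f₂ with f | f <;> simp [f, h]
    · refine ⟨_, Exec.cond_cons h (by cases b <;> exact exec_pop O s' 2), by simp [f₀], ?_⟩
      rw [← if_congr f₃ rfl rfl]
      rcases f₂ with f | f <;> simp [f, h]
  obtain ⟨s₃, e₃, k⟩ : ∃ s₃, Exec O (.cond 2 (.push 0 false) .skip (.push 0 true)) s'' 2
      (PMF.pure s₃) ∧ s₃ 0 = [decide (a 0 = a 1)] := by
    by_cases h : a 0 = a 1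
    · rw [if_pos h] at g₂
      exact ⟨_, Exec.cond_cons g₂ (exec_push O s'' 0 true), by simp [g₀, h]⟩
    · rw [if_neg h] at g₂
      exact ⟨_, Exec.cond_nil g₂ (exec_push O s'' 0 false), by simp [g₀, h]⟩
  exact ⟨s₃, (e₀.seq_pure (e₁.seq_pure (e₂.seq_pure e₃))).mono (by simp; omega), k, by simp⟩

end Basic

/-! ### A query with a bound on the length of the answer -/

/-- Move the top of register `3` to register `4`, once for each symbol of register `0`. -/
def truncLoop : Prog := .loop 0 (.seq (.pop 0) (.cond 3 .skip (.seq (.pop 3) (.push 4 false))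
  (.seq (.pop 3) (.push 4 true))))

theorem exec_truncLoop (O : Oracle) : ∀ (u : Str) (s : Regs), s 0 = u → ∃ s',
    Exec O truncLoop s (7 * u.length + 1) (PMF.pure s') ∧ s' 0 = [] ∧
      s' 4 = ((s 3).take u.length).reverse ++ s 4 := by
  intro u
  induction u with
  | nil => exact fun s hs => ⟨s, exec_loop_nil hs, hs, by simp⟩
  | cons b u ih =>
    intro s hs
    suffices h : ∃ s₁, Exec O (.cond 3 .skip (.seq (.pop 3) (.push 4 false))
        (.seq (.pop 3) (.push 4 true))) (Function.update s 0 (s 0).tail) 4 (PMF.pure s₁) ∧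
        s₁ 0 = u ∧ ((s₁ 3).take u.length).reverse ++ s₁ 4 =
          ((s 3).take (b :: u).length).reverse ++ s 4 by
      obtain ⟨s₁, h₁, h₂, h₃⟩ := h
      obtain ⟨s', h₄, h₅, h₆⟩ := ih s₁ h₂
      exact ⟨s', (Exec.loop_cons (by simp [hs]) ((exec_pop O s 0).seq_pure h₁) h₄).mono
        (by simp; omega), h₅, h₆.trans h₃⟩
    rcases h : s 3 with _ | ⟨b', l⟩
    · exact ⟨_, (Exec.cond_nil (by simp [h]) (exec_skip O _)).mono (by omega), by simp [hs],
        by simp [h]⟩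
    · refine ⟨_, Exec.cond_cons (b := b') (l := l) (by simp [h]) (T := 3) (?_ : Exec _ _ _ _
        (PMF.pure (Function.update (Function.update (Function.update s 0 (s 0).tail) 3 l) 4
          (b' :: s 4)))), by simp [hs], by simp⟩
      cases b'
      · simpa [h] using (exec_pop O (Function.update s 0 (s 0).tail) 3).seq_pure
          (exec_push O _ 4 false)
      · simpa [h] using (exec_pop O (Function.update s 0 (s 0).tail) 3).seq_pure
          (exec_push O _ 4 true)

/-- Query the oracle, keeping only one symbol more of the answer than the length of `a 0`. -/
theorem efficient_query : Efficient AnyProg fun O (a : Fin 3 → Str) =>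
    (O (a 1) (a 2)).map (List.take ((a 0).length + 1)) := by
  -- The pushed bit accounts for the `+ 1` in the prefix length. The number of symbols copied is
  -- governed by the counter in register `0`, never by the length of the answer.
  refine Efficient.of_exec (c := .seq (.query 1 2 3) (.seq (.push 0 true)
    (.seq truncLoop (moveTo 4 [0])))) (16 * Polynomial.X + 40) trivial fun O a => ?_
  have hlen : inputLength a = (a 0).length + (a 1).length + (a 2).length := by
    simp [inputLength, Fin.sum_univ_three]
  have h1 : startRegs a 1 = a 1 := rfl
  have h2 : startRegs a 2 = a 2 := rfl
  have h4 : startRegs a 4 = [] := rfl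
  have e₁ := exec_query O (startRegs a) 1 2 3
  simp only [h1, h2] at e₁
  have key : ∀ s₁ ∈ ((O (a 1) (a 2)).map (Function.update (startRegs a) 3)).support, ∃ s',
      Exec O (.seq (.push 0 true) (.seq truncLoop (moveTo 4 [0]))) s₁ (15 * (a 0).length + 29)
        (PMF.pure s') ∧ s' 0 = (s₁ 3).take ((a 0).length + 1) := by
    intro s₁ hs₁
    obtain ⟨y, -, rfl⟩ := (PMF.mem_support_map_iff _ _ _).1 hs₁
    have e₂ := exec_push O (Function.update (startRegs a) 3 y) 0 true
    obtain ⟨s₂, e₃, f₀, f₄⟩ := exec_truncLoop O (true :: a 0) _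
      (show Function.update (Function.update (startRegs a) 3 y) 0
        (true :: Function.update (startRegs a) 3 y 0) 0 = true :: a 0 from rfl)
    have f₄' : s₂ 4 = (y.take ((a 0).length + 1)).reverse := by simpa [h4] using f₄
    have e₄ := exec_moveTo O 4 (l := [0]) (by simp) (by simp) _ s₂ f₄'
    refine ⟨_, (e₂.seq_pure (e₃.seq_pure e₄)).mono ?_, by simp [f₀]⟩
    have := List.length_take_le ((a 0).length + 1) y
    simp only [List.length_reverse, List.length_nil, List.length_cons]
    omega
  choose! f hf hf0 using key
  refine ⟨_, (e₁.seq (ξ := fun s => PMF.pure (f s)) hf).mono ?_, ?_, ?_⟩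
  · simp; omega
  · rw [PMF.map_bind, PMF.bind_map]
    simp only [Function.comp_def, PMF.pure_map]
    rw [← PMF.bind_pure_comp]
    refine bind_congr_support _ fun y hy => ?_
    have := hf0 _ ((PMF.mem_support_map_iff (Function.update (startRegs a) 3) _ _).2 ⟨y, hy, rfl⟩)
    simp [outStr, this]
  · intro y hy
    obtain ⟨z, -, rfl⟩ := (PMF.mem_support_map_iff _ _ _).1 hy
    have := List.length_take_le ((a 0).length + 1) z
    simp; omega

/-! ### Composition with deterministic functions -/

section Let

variable {P : Prog → Prop} [ProgClass P] {k m : ℕ}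

/-- Compute a function of some of the inputs, and then run an algorithm on its value and all the
inputs. -/
theorem EfficientFun.bind {f : (Fin k → Str) → Str} {G : Oracle → (Fin (m + 1) → Str) → PMF Str}
    (hf : EfficientFun P f) (σ : Fin k → Fin m) (hG : Efficient P G) :
    Efficient P fun O (a : Fin m → Str) =>
      G O (Fin.cons (f fun i => a (σ i)) a : Fin (m + 1) → Str) := by
  simpa only [PMF.pure_bind] using Efficient.bind hf σ hG

theorem Efficient.reindex {F : Oracle → (Fin k → Str) → PMF Str} (hF : Efficient P F)
    (σ : Fin k → Fin m) : Efficient P fun O (a : Fin m → Str) => F O fun i => a (σ i) := by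
  simpa only [Fin.cons_zero, PMF.bind_pure] using hF.bind σ (efficientFun_head P m)

end Let

/-! ### Conversions between the notions of efficiency -/

theorem Efficient.of_isPPT {k : ℕ} {F : (Fin k → Str) → PMF Str} (h : IsPPT outStr F) :
    Efficient Prog.OracleFree fun _ => F := by
  obtain ⟨c, q, hc, h⟩ := h
  have := Efficient.of_outputsWithin (F := fun _ => F) hc hc h
  simpa only [funext fun O => funext fun a => (h O a).2] using this

theorem Efficient.isPPT {k : ℕ} {F : (Fin k → Str) → PMF Str}
    (h : Efficient Prog.OracleFree fun _ => F) : IsPPT outStr F := by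
  obtain ⟨c, q, hc, h⟩ := h
  exact ⟨c, q, hc, fun O a => (h O a).1⟩

theorem EfficientFun.of_isPolyTime {k : ℕ} {f : (Fin k → Str) → Str} (h : IsPolyTime outStr f) :
    EfficientFun Deterministic f := by
  obtain ⟨c, q, h₁, h₂, h⟩ := h
  have := Efficient.of_outputsWithin (P := Deterministic) (F := fun _ a => PMF.pure (f a))
    ⟨h₁, h₂⟩ h₁ h
  simpa only [funext fun O => funext fun a => (h O a).2] using this

theorem EfficientFun.isPolyTime {k : ℕ} {f : (Fin k → Str) → Str}
    (h : EfficientFun Deterministic f) : IsPolyTime outStr f := by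
  obtain ⟨c, q, hc, h⟩ := h
  exact ⟨c, q, hc.1, hc.2, fun O a => (h O a).1⟩

theorem EfficientFun.fst_of_isPolyTime {k : ℕ} {f : (Fin k → Str) → Str × Str}
    (h : IsPolyTime outPair f) : EfficientFun Deterministic fun a => (f a).1 := by
  obtain ⟨c, q, h₁, h₂, h⟩ := h
  have := Efficient.of_outputsWithin (P := Deterministic) (F := fun _ a => PMF.pure (f a))
    ⟨h₁, h₂⟩ h₁ h
  have h₃ : ∀ O a, (run O (q.eval (inputLength a)) (start c a)).map (fun γ => outStr γ.regs) =
      PMF.pure (f a).1 := fun O a => by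
    rw [← PMF.pure_map, ← (h O a).2, PMF.map_comp]
    rfl
  simpa only [funext fun O => funext fun a => h₃ O a] using this

/-- Exchanging registers `0` and `1` throughout the program brings the second component to the
output register. It also exchanges the two inputs, which the final reindexing undoes. -/
theorem EfficientFun.snd_of_isPolyTime {f : (Fin 2 → Str) → Str × Str}
    (h : IsPolyTime outPair f) : EfficientFun Deterministic fun a => (f a).2 := by
  obtain ⟨c, q, h₁, h₂, h⟩ := h
  have hswap : EfficientFun Deterministic fun a : Fin 2 → Str => (f ![a 1, a 0]).2 := by
    refine Efficient.of_exec (c := c.rename (Equiv.swap 0 1)) (q + Polynomial.X)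
      (ProgClass.rename _ ⟨h₁, h₂⟩) fun O a => ?_
    have hlen : inputLength ![a 1, a 0] = inputLength a := by
      simp [inputLength, add_comm]
    have e := (h O ![a 1, a 0]).exec (Equiv.swap 0 1).injective (s := startRegs a) (by
      rintro (_ | _ | i)
      · rfl
      · rfl
      · rw [Equiv.swap_apply_of_ne_of_ne (by omega) (by omega)]
        simp [startRegs])
    have hout : (((run O (q.eval (inputLength ![a 1, a 0])) (start c ![a 1, a 0])).map
        Config.regs).map fun u => u 1) = PMF.pure (f ![a 1, a 0]).2 := by
      rw [← PMF.pure_map, ← (h O ![a 1, a 0]).2, PMF.map_comp, PMF.map_comp]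
      rfl
    refine ⟨_, e.mono (by simp [hlen]), ?_, ?_⟩
    · rw [← hout]
      refine (PMF.map_comp _ _ _).trans (congrArg (fun g => PMF.map g _) (funext fun u => ?_))
      exact (Equiv.swap 0 1).injective.extend_apply u (startRegs a) 1
    · intro y hy
      rw [← hout] at hy
      obtain ⟨u, hu, rfl⟩ := (PMF.mem_support_map_iff _ _ _).1 hy
      have := outputsWithin_length_le h₁ hu 1
      simp only [Polynomial.eval_add, Polynomial.eval_X]
      rw [hlen] at this
      omega
  have := hswap.reindex (m := 2) ![1, 0]
  refine (congrArg (Efficient Deterministic) ?_).mp this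
  funext O a
  have : ![a 0, a 1] = a := by
    funext i
    fin_cases i <;> rfl
  change PMF.pure (f ![a 0, a 1]).2 = _
  rw [this]

/-- Under `outBit` every string other than `[true]` means rejection; comparing the output with
`[true]` normalises it to a single bit that can be passed on. -/
theorem EfficientFun.of_isPolyTime_outBit {k : ℕ} {f : (Fin k → Str) → Bool}
    (h : IsPolyTime outBit f) : EfficientFun Deterministic fun a => [f a] := by
  obtain ⟨c, q, h₁, h₂, h⟩ := h
  have h₃ := Efficient.of_outputsWithin (P := Deterministic) (F := fun _ a => PMF.pure (f a))
    ⟨h₁, h₂⟩ h₁ h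
  have h₄ : EfficientFun Deterministic fun a : Fin (k + 1) → Str => [decide (a 0 = [true])] :=
    (efficientFun_true Deterministic).bind (fun i => i.elim0)
      ((efficientFun_eq Deterministic).reindex ![1, 0])
  refine (congrArg (Efficient Deterministic) ?_).mp (h₃.bind id h₄)
  funext O a
  rw [← PMF.pure_map (fun b : Bool => [b]), ← (h O a).2, PMF.bind_map, PMF.map_comp,
    ← PMF.bind_pure_comp]
  rfl

theorem Efficient.outBit {P : Prog → Prop} {k : ℕ} {F : Oracle → (Fin k → Str) → PMF Bool}
    (h : Efficient P fun O a => (F O a).map fun b => [b]) :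
    ∃ (c : Prog) (q : Polynomial ℕ), P c ∧ ∀ (O : Oracle) (a : Fin k → Str),
      c.OutputsWithin outBit O a (q.eval (inputLength a)) (F O a) := by
  obtain ⟨c, q, hc, h⟩ := h
  refine ⟨c, q, hc, fun O a => ⟨(h O a).1.1, ?_⟩⟩
  have := congrArg (PMF.map fun u : Str => decide (u = [true])) (h O a).1.2
  rw [PMF.map_comp, PMF.map_comp] at this
  refine this.trans ?_
  have hid : ((fun u : Str => decide (u = [true])) ∘ fun b : Bool => [b]) = id := by
    funext b
    cases b <;> rfl
  rw [hid, PMF.map_id]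

theorem EfficientFun.anyProg {k : ℕ} {f : (Fin k → Str) → Str}
    (h : EfficientFun Deterministic f) : EfficientFun AnyProg f := h.mono fun _ _ => trivial

theorem EfficientFun.oracleFree {k : ℕ} {f : (Fin k → Str) → Str}
    (h : EfficientFun Deterministic f) : EfficientFun Prog.OracleFree f := h.mono fun _ h => h.1

/-! ### Probabilities of acceptance -/

/-- Averaging a pointwise bound over `μ`. The sums are compared in `ENNReal`, where summability is
no concern. -/
theorem Pr_bind_le_add {α : Type} (μ : PMF α) {f g h : α → PMF Bool}
    (hfg : ∀ a, Pr (f a) ≤ Pr (g a) + Pr (h a)) :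
    Pr (μ.bind f) ≤ Pr (μ.bind g) + Pr (μ.bind h) := by
  unfold Pr at *
  rw [← ENNReal.toReal_add (PMF.apply_ne_top _ _) (PMF.apply_ne_top _ _)]
  refine ENNReal.toReal_mono (ENNReal.add_ne_top.2 ⟨PMF.apply_ne_top _ _, PMF.apply_ne_top _ _⟩) ?_
  simp only [PMF.bind_apply]
  rw [← ENNReal.tsum_add]
  refine ENNReal.tsum_le_tsum fun a => ?_
  rw [← mul_add]
  refine mul_le_mul_right ?_ _
  have := hfg a
  rwa [← ENNReal.toReal_add (PMF.apply_ne_top _ _) (PMF.apply_ne_top _ _),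
    ENNReal.toReal_le_toReal (PMF.apply_ne_top _ _)
      (ENNReal.add_ne_top.2 ⟨PMF.apply_ne_top _ _, PMF.apply_ne_top _ _⟩)] at this

theorem Pr_nonneg (p : PMF Bool) : 0 ≤ Pr p := ENNReal.toReal_nonneg

theorem Pr_le_one (p : PMF Bool) : Pr p ≤ 1 :=
  ENNReal.toReal_mono ENNReal.one_ne_top (PMF.coe_le_one _ _)

theorem Pr_pure (b : Bool) : Pr (PMF.pure b) = if b then 1 else 0 := by
  cases b <;> simp [Pr]

theorem Pr_bind_mono {α : Type} (μ : PMF α) {f g : α → PMF Bool}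
    (hfg : ∀ a, Pr (f a) ≤ Pr (g a)) : Pr (μ.bind f) ≤ Pr (μ.bind g) := by
  have := Pr_bind_le_add μ (f := f) (g := g) (h := fun _ => PMF.pure false) fun a => by
    simpa [Pr_pure] using hfg a
  simpa [Pr_pure] using this

theorem Pr_map_mono {α : Type} (μ : PMF α) {f g : α → Bool} (hfg : ∀ a, f a = true → g a = true) :
    Pr (μ.map f) ≤ Pr (μ.map g) := by
  rw [← PMF.bind_pure_comp, ← PMF.bind_pure_comp]
  refine Pr_bind_mono μ fun a => ?_
  have := hfg a
  simp only [Function.comp_apply, Pr_pure]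
  cases h : f a <;> cases h' : g a <;> simp_all

theorem Pr_map_not (p : PMF Bool) : Pr (p.map not) = 1 - Pr p := by
  have h₁ : (p.map not) true = p false := by
    rw [PMF.map_apply, tsum_bool]
    simp
  have h₂ : p false + p true = 1 := by
    rw [← p.tsum_coe, tsum_bool]
  unfold Pr
  rw [h₁, eq_sub_iff_add_eq, ← ENNReal.toReal_add (PMF.apply_ne_top _ _) (PMF.apply_ne_top _ _), h₂]
  rfl

/-! ### The function family and the reduction -/

section Reduction

variable (Z : NIProtocol) (S : Simulator)

/-- The verdict on the simulated view, followed by the simulated reference string. -/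
def simFun (x ρ : Str) : Str := Z.V x (S.sim x ρ).1 (S.sim x ρ).2 :: (S.sim x ρ).1

/-- Is `ρ` a preimage of `y` among the coins of the simulator? -/
def isPreimage (x y ρ : Str) : Bool := decide (ρ.length = S.ℓ x.length ∧ simFun Z S x ρ = y)

/-- Sample a reference string `r`, ask the oracle for simulator coins that lead to `r` and an
accepting proof, and check the answer. -/
noncomputable def reduction (O : Oracle) (x : Str) : PMF Bool :=
  (Z.Gen (unary x.length)).bind fun r => (O x (true :: r)).map (isPreimage Z S x (true :: r))

/-- Given the reference string `r`, send the proof simulated with coins that the inverter `A` finds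
for `r`. -/
noncomputable def cheatingProver (A : Str → Str → PMF Str) (x r : Str) : PMF Str :=
  (A x (true :: r)).map fun ρ => (S.sim x ρ).2

/-- Does `A` invert the function at the value given by the view `v`? -/
noncomputable def inversionTest (A : Str → Str → PMF Str) (x : Str) (v : Str × Str) : PMF Bool :=
  (A x (Z.V x v.1 v.2 :: v.1)).map (isPreimage Z S x (Z.V x v.1 v.2 :: v.1))

theorem unary_inj {m n : ℕ} : unary m = unary n ↔ m = n :=
  ⟨fun h => by simpa [unary] using congrArg List.length h, fun h => h ▸ rfl⟩

/-- In such chains of `bind`, each new value becomes argument `0` and the earlier ones shift up by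
one. The vectors `![…]` are thus de Bruijn indices. -/
theorem efficientFun_simFun :
    EfficientFun Deterministic fun a : Fin 2 → Str => simFun Z S (a 0) (a 1) :=
  (EfficientFun.fst_of_isPolyTime S.sim_polyTime).bind (m := 2) ![0, 1] <|
    (EfficientFun.snd_of_isPolyTime S.sim_polyTime).bind (m := 3) ![1, 2] <|
    (EfficientFun.of_isPolyTime_outBit Z.v_polyTime).bind (m := 4) ![2, 1, 0] <|
    (efficientFun_consBit Deterministic).reindex (m := 5) ![2, 0]

theorem efficientFun_isPreimage :
    EfficientFun Deterministic fun a : Fin 3 → Str => [isPreimage Z S (a 0) (a 1) (a 2)] := by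
  have h : EfficientFun Deterministic fun a : Fin 3 → Str =>
      andBit [decide (unary (a 2).length = unary (S.ℓ (a 0).length))]
        [decide (simFun Z S (a 0) (a 2) = a 1)] :=
    (EfficientFun.of_isPolyTime S.ℓ_polyTime).bind (m := 3) ![0] <|
      (efficientFun_unary Deterministic).bind (m := 4) ![3] <|
      (efficientFun_eq Deterministic).bind (m := 5) ![0, 1] <|
      (efficientFun_simFun Z S).bind (m := 6) ![3, 5] <|
      (efficientFun_eq Deterministic).bind (m := 7) ![0, 5] <|
      (efficientFun_andBit Deterministic).reindex (m := 8) ![2, 0]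
  refine (congrArg (Efficient Deterministic) ?_).mp h
  funext O a
  by_cases h₁ : (a 2).length = S.ℓ (a 0).length <;>
    by_cases h₂ : simFun Z S (a 0) (a 2) = a 1 <;>
      simp [unary_inj, isPreimage, h₁, h₂, andBit]

/-- A string too long to be a preimage still has length `ℓ + 1` after truncation, hence is still
refused; valid ones are unchanged. So truncating oracle answers does not affect the reduction. -/
theorem isPreimage_take (x y ρ : Str) :
    isPreimage Z S x y (ρ.take (S.ℓ x.length + 1)) = isPreimage Z S x y ρ := by
  unfold isPreimage
  by_cases h : ρ.length ≤ S.ℓ x.length + 1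
  · rw [List.take_of_length_le h]
  · have h₁ : (ρ.take (S.ℓ x.length + 1)).length ≠ S.ℓ x.length := by
      rw [List.length_take]; omega
    have h₂ : ρ.length ≠ S.ℓ x.length := by omega
    simp only [h₁, h₂, false_and]

theorem isPolyTimeOracleAlg_reduction : IsPolyTimeOracleAlg (reduction Z S) := by
  have h := (efficientFun_unary AnyProg).bind (m := 1) ![0] <|
    ((Efficient.of_isPPT Z.gen_ppt).mono (P' := AnyProg) fun _ _ => trivial).bind (m := 2) ![0] <|
    (efficientFun_cons AnyProg true).bind (m := 3) ![0] <|
    (EfficientFun.of_isPolyTime S.ℓ_polyTime).anyProg.bind (m := 4) ![3] <|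
    efficient_query.bind (m := 5) ![0, 4, 1] <|
    (efficientFun_isPreimage Z S).anyProg.reindex (m := 6) ![5, 2, 0]
  obtain ⟨c, q, -, hc⟩ := Efficient.outBit (F := fun O (a : Fin 1 → Str) => reduction Z S O (a 0))
    ((congrArg (Efficient AnyProg) (by
      funext O a
      simp only [reduction, PMF.map_bind, PMF.map_comp]
      refine congrArg (PMF.bind (Z.Gen (unary (a 0).length))) (funext fun r => ?_)
      rw [← PMF.bind_pure_comp]
      refine (PMF.bind_map _ _ _).trans (congrArg (PMF.bind (O (a 0) (true :: r)))
        (funext fun ρ => congrArg (fun b => PMF.pure [b]) ?_))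
      have : (unary (S.ℓ (a 0).length)).length = S.ℓ (a 0).length := List.length_replicate
      rw [← isPreimage_take Z S (a 0) (true :: r) ρ, ← this]
      rfl)).mp h)
  exact ⟨c, q, fun O x => by simpa [inputLength] using hc O ![x]⟩

theorem isPPT_cheatingProver {A : Str → Str → PMF Str}
    (hA : IsPPT outStr fun a : Fin 2 → Str => A (a 0) (a 1)) :
    IsPPT outStr fun a : Fin 2 → Str => cheatingProver S A (a 0) (a 1) := by
  have h := (efficientFun_cons Prog.OracleFree true).bind (m := 2) ![1] <|
    (Efficient.of_isPPT hA).bind (m := 3) ![1, 0] <|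
    (EfficientFun.snd_of_isPolyTime S.sim_polyTime).oracleFree.reindex (m := 4) ![2, 0]
  exact h.isPPT

/-- Makes the test an admissible distinguisher; the first argument, `x`, plays the role of the
advice. -/
theorem isPPT_inversionTest {A : Str → Str → PMF Str}
    (hA : IsPPT outStr fun a : Fin 2 → Str => A (a 0) (a 1)) :
    IsPPT outBit fun a : Fin 3 → Str => inversionTest Z S A (a 0) (a 1, a 2) := by
  have h := (EfficientFun.of_isPolyTime_outBit Z.v_polyTime).oracleFree.bind (m := 3) ![0, 1, 2] <|
    (efficientFun_consBit Prog.OracleFree).bind (m := 4) ![2, 0] <|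
    (Efficient.of_isPPT hA).bind (m := 5) ![2, 0] <|
    (efficientFun_isPreimage Z S).oracleFree.reindex (m := 6) ![3, 1, 0]
  refine Efficient.outBit (F := fun _ (a : Fin 3 → Str) => inversionTest Z S A (a 0) (a 1, a 2))
    ((congrArg (Efficient Prog.OracleFree) ?_).mp h)
  funext O a
  rw [inversionTest, PMF.map_comp, ← PMF.bind_pure_comp]
  rfl

/-- Couple both experiments through the same `r` and the same answer `ρ`: if `ρ` is a preimage of
`true :: r`, the simulated reference string is `r` and the simulated proof is accepted. -/
theorem Pr_reduction_le_verdict (A : Str → Str → PMF Str) (x : Str) :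
    Pr (reduction Z S A x) ≤ Pr (Z.verdict (cheatingProver S A) x) := by
  refine Pr_bind_mono _ fun r => ?_
  rw [cheatingProver, PMF.map_comp]
  refine Pr_map_mono _ fun ρ h => ?_
  obtain ⟨-, h⟩ := of_decide_eq_true h
  obtain ⟨h₁, h₂⟩ := List.cons_eq_cons.1 h
  simpa [h₂] using h₁

/-- Both the challenge and the success condition depend on `ρ` only through `S.sim x ρ`. -/
theorem inverts_eq (A : Str → Str → PMF Str) (x : Str) :
    inverts (simFun Z S) (S.ℓ x.length) A x = (S.dist x).bind (inversionTest Z S A x) := by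
  rw [Simulator.dist, PMF.bind_map]
  rfl

/-- On a real view, the inversion succeeds only if it succeeds at an accepting value, or the
verifier rejects. -/
theorem Pr_inversionTest_view_le (A : Str → Str → PMF Str) (x w : Str) :
    Pr ((Z.view x w).bind (inversionTest Z S A x)) ≤
      Pr (reduction Z S A x) + (1 - Pr (Z.verdict (fun x r => Z.P x w r) x)) := by
  have h := Pr_bind_le_add (Z.view x w) (f := inversionTest Z S A x)
    (g := fun v => (A x (true :: v.1)).map (isPreimage Z S x (true :: v.1)))
    (h := fun v => PMF.pure (!Z.V x v.1 v.2)) fun v => by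
      unfold inversionTest
      -- On a rejecting view the last term is `1` and the bound is trivial; on an accepting one the
      -- two tests coincide.
      cases Z.V x v.1 v.2
      · simpa [Pr_pure] using (Pr_le_one _).trans (le_add_of_nonneg_left (Pr_nonneg _))
      · simp [Pr_pure]
  -- With the verdict fixed to `true`, the test no longer looks at the honest proof, and only the
  -- sampling of `r` remains.
  have h₁ : (Z.view x w).bind (fun v => (A x (true :: v.1)).map (isPreimage Z S x (true :: v.1))) =
      reduction Z S A x := by
    simp only [NIProtocol.view, reduction, PMF.bind_bind, PMF.bind_map, Function.comp_def,
      PMF.bind_const]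
  have h₂ : (Z.view x w).bind (fun v => PMF.pure (!Z.V x v.1 v.2)) =
      (Z.verdict (fun x r => Z.P x w r) x).map not := by
    simp only [NIProtocol.view, NIProtocol.verdict, PMF.bind_bind, PMF.map_bind, PMF.map_comp,
      PMF.bind_map]
    refine congrArg _ (funext fun r => ?_)
    rw [← PMF.bind_pure_comp]
    rfl
  rwa [h₁, h₂, Pr_map_not] at h

end Reduction

end WeakZK

/-! ### The main result -/

theorem lemma3p1
    (εc εs εz : ℕ → Set.Icc (0 : ℝ) 1)
    (L : Set Str) (Rel : Str → Str → Bool) (hL : IsNPRelation L Rel)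
    (Z : NIProtocol)
    (hZ : IsNIZKProof Z L Rel (fun n => εc n) (fun n => εs n) (fun n => εz n) ∨
      IsNIZKArgument Z L Rel (fun n => εc n) (fun n => εs n) (fun n => εz n))
    (S : Simulator) (hS : S.ZeroKnowledge Z Rel (fun n => εz n)) :
    ∃ (R : Oracle → Str → PMF Bool) (F : Str → Str → Str),
      IsPolyTimeOracleAlg R ∧
      IsPolyTime outStr (fun a : Fin 2 → Str => F (a 0) (a 1)) ∧
      -- `f_x(ρ)` is the pair `(r, V(x; r, π))` with `(r, π) = Sim(x; ρ)`, written as a string with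
      -- the verdict bit first
      (∀ x ρ, F x ρ = Z.V x (S.sim x ρ).1 (S.sim x ρ).2 :: (S.sim x ρ).1) ∧
      ∀ A : Str → Str → PMF Str, IsPPT outStr (fun a : Fin 2 → Str => A (a 0) (a 1)) →
        ∀ p : Polynomial ℝ, ∃ N : ℕ, ∀ n ≥ N, ∀ x : Str, x.length = n →
          (x ∈ L → 1 - 1 / p.eval (n : ℝ) ≤ Pr (inverts F (S.ℓ n) A x) →
            1 - (εc n : ℝ) - εz n - 1 / p.eval (n : ℝ) ≤ Pr (R A x)) ∧
          (x ∉ L → Pr (R A x) ≤ εs n) := by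
  refine ⟨reduction Z S, simFun Z S, isPolyTimeOracleAlg_reduction Z S,
    (efficientFun_simFun Z S).isPolyTime, fun _ _ => rfl, fun A hA p => ?_⟩
  have hcomp : Z.Complete Rel fun n => εc n := hZ.elim (·.1) (·.2.1)
  obtain ⟨N₁, hN₁⟩ : ∃ N : ℕ, ∀ n ≥ N, ∀ x : Str, x.length = n → x ∉ L →
      Pr (reduction Z S A x) ≤ εs n := by
    -- For proofs the bound holds at every length; for arguments the threshold is that of the
    -- cheating prover built from `A`.
    rcases hZ with ⟨-, hs, -⟩ | ⟨-, -, hs, -⟩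
    · exact ⟨0, fun n _ x hx hxL => (Pr_reduction_le_verdict Z S A x).trans (hx ▸ hs _ x hxL)⟩
    · obtain ⟨N, hN⟩ := hs _ (isPPT_cheatingProver S hA)
      exact ⟨N, fun n hn x hx hxL => (Pr_reduction_le_verdict Z S A x).trans (hN n hn x hxL hx)⟩
  -- The advice is an input on which the first claim fails, whenever there is one.
  have hadv : ∀ n : ℕ, ∃ x : Str, x.length = n ∧ ∀ x' : Str, x'.length = n →
      (x ∈ L → 1 - 1 / p.eval (n : ℝ) ≤ Pr (inverts (simFun Z S) (S.ℓ n) A x) →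
        1 - (εc n : ℝ) - εz n - 1 / p.eval (n : ℝ) ≤ Pr (reduction Z S A x)) →
      (x' ∈ L → 1 - 1 / p.eval (n : ℝ) ≤ Pr (inverts (simFun Z S) (S.ℓ n) A x') →
        1 - (εc n : ℝ) - εz n - 1 / p.eval (n : ℝ) ≤ Pr (reduction Z S A x')) := by
    intro n
    -- Otherwise every `x` of length `n` satisfies the claim while some other input fails it.
    -- Starting from any string, here `unary n`, this gives a failing input, which would have to
    -- satisfy the claim.
    by_contra! hcon
    obtain ⟨x, hx, -, hx₁, hx₂, hx₃⟩ := hcon (unary n) List.length_replicate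
    obtain ⟨-, -, h, -, -⟩ := hcon x hx
    exact (h hx₁ hx₂).not_gt hx₃
  choose advice hlen hadv using hadv
  obtain ⟨N₂, hN₂⟩ := hS (inversionTest Z S A) (isPPT_inversionTest Z S hA) advice
    ⟨Polynomial.X, fun n => by simp [hlen n]⟩
  refine ⟨max N₁ N₂, fun n hn x hx => ⟨hadv n x hx fun hxL hinv => ?_,
    hN₁ n ((le_max_left _ _).trans hn) x hx⟩⟩
  -- Only the input `advice n` is left to treat, and it is exactly the one the distinguisher knows.
  obtain ⟨w, hw⟩ := (hL.2.2 _).1 hxL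
  have h₁ := hN₂ n ((le_max_right _ _).trans hn) ⟨(advice n, w), hw⟩ (hlen n)
  have h₂ := Pr_inversionTest_view_le Z S A (advice n) w
  have h₃ := hcomp (advice n) w hw
  have h₄ := inverts_eq Z S A (advice n)
  rw [hlen] at h₃ h₄
  rw [h₄] at hinv
  -- Only one direction is needed: the test passes on simulated views at most `εz` more often than
  -- on real ones.
  have h₅ := (abs_le.1 h₁).2
  simp only at h₅
  linarith
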